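/- Let $R$ be a commutative ring, $A$ an associative unital $R$-algebra which is flat as an $R$-module, and $M$ an $(A,A)$-bimodule on which the two $R$-actions agree; write $\otimes=\otimes_R$. For $n\ge 1$ let $\mathtt P_n$ be the coherently oriented polygon with vertices $v_0<v_1<\dots<v_n$ and the $n+1$ edges $v_0\to v_1\to\cdots\to v_n\to v_0$ (a digon if $n=1$). For every $i=1,\dots,n$ there are isomorphisms of $R$-modules $$\mathrm H^i_\mu(\mathtt P_n;A,M)\;\cong\;\widehat{\mathrm H}{}^i_{\rm Chrom}(\mathtt P_n;A,M)\;\cong\;\mathrm{HH}_{n-i}(A,M),$$ where the three terms are defined as follows. *Coefficients.* Let $\mathtt G$ be a digraph with a linear order on its vertices and least vertex $v_0$. A spanning sub-graph $\mathtt H$ of $\mathtt G$ has the same vertices as $\mathtt G$ and a subset of its edges. Order the connected components of $\mathtt H$ by their least vertices, $c_0<\dots<c_k$ (so $v_0\in c_0$), and put $\mathcal F(\mathtt H)=M_{c_0}\otimes A_{c_1}\otimes\dots\otimes A_{c_k}$. If an edge $e\notin\mathtt H$ goes from $c_s$ to $c_t$ with $s\ne t$, the map $\mu_{\mathtt H,e}\colon\mathcal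 F(\mathtt H)\to\mathcal F(\mathtt H\cup e)$ replaces the factors $x_s$ and $x_t$ of $x_0\otimes\dots\otimes x_k$ by the single factor $x_s x_t$, placed at the merged component $c_s\cup e\cup c_t$; if $s=t$, put $\mu_{\mathtt H,e}=0$. *Multipath cohomology.* A multipath of $\mathtt G$ is a spanning sub-graph each of whose connected components is a single vertex or has edges that can be ordered into a simple (non-closed) directed path. $\mathrm H^*_\mu(\mathtt G;A,M)$ is the cohomology of the complex $C^i_\mu=\bigoplus\mathcal F(\mathtt H)$, summed over the multipaths $\mathtt H$ with $i$ edges, whose differential on $\mathcal F(\mathtt H)$ is $\sum_e(-1)^{\sigma(\mathtt H,e)}\mu_{\mathtt H,e}$, summed over the edges $e\notin\mathtt H$ for which $\mathtt H\cup e$ is a multipath; for $e$ going from $c_s$ to $c_t$, $\sigma(\mathtt H,e)=t+1$ if $s<t$ and $\sigma(\mathtt H,e)=s$ if $s>t$. *Chromatic homology (Przytycki's version).* $\widehat{\mathrm H}{}^*_{\rm Chrom}(\mathtt P_n;A,M)$ is the cohomology of the complex $\widehat C^i_{\rm Chrom}=\bigoplus\mathcal F(\mathtt H)$, summed over all spanning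 sub-graphs $\mathtt H$ of $\mathtt P_n$ with $i$ edges, whose differential on $\mathcal F(\mathtt H)$ is $\sum_{e\notin\mathtt H}(-1)^{\zeta(\mathtt H,e)}\mu_{\mathtt H,e}$, where $\zeta(\mathtt H,e)$ is the number of edges of $\mathtt H$ that precede $e$ in the order $v_0\to v_1,\ v_1\to v_2,\ \dots,\ v_n\to v_0$. *Hochschild homology.* $\mathrm{HH}_*(A,M)$ is the homology of the Hochschild complex $(M\otimes A^{\otimes k})_{k\ge0}$ with $$b(m\otimes a_1\otimes\dots\otimes a_k)=ma_1\otimes a_2\otimes\dots\otimes a_k+\sum_{j=1}^{k-1}(-1)^j\,m\otimes a_1\otimes\dots\otimes a_ja_{j+1}\otimes\dots\otimes a_k+(-1)^k a_km\otimes a_1\otimes\dots\otimes a_{k-1}.$$ -/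

import Mathlib

open scoped TensorProduct DirectSum

noncomputable section

namespace MultipathHH

/-! ## Digraphs, spanning sub-graphs and multipaths -/

/-- A (finite, loopless, simple) digraph with vertex set `V`. -/
structure FinDigraph (V : Type*) where
  edges : Finset (V × V)
  loopless : ∀ e ∈ edges, e.1 ≠ e.2

section Graphs

variable {V : Type*}

/- A spanning sub-graph of a digraph `G` on `V` has the same vertices as `G`, so it is given by its
edge set, a finite set `H ⊆ G.edges`.  Below, `H : Finset (V × V)` is such an edge set. -/

/-- `a` and `b` lie in the same connected component of the graph with edge set `H`
(orientations of the edges are disregarded). -/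
def Conn (H : Finset (V × V)) : V → V → Prop :=
  Relation.EqvGen fun a b => (a, b) ∈ H

theorem Conn.refl (H : Finset (V × V)) (a : V) : Conn H a a := Relation.EqvGen.refl a

theorem Conn.symm {H : Finset (V × V)} {a b : V} (h : Conn H a b) : Conn H b a :=
  Relation.EqvGen.symm _ _ h

theorem Conn.trans {H : Finset (V × V)} {a b c : V} (h : Conn H a b) (h' : Conn H b c) :
    Conn H a c := Relation.EqvGen.trans _ _ _ h h'

/-- The edges `e 0, …, e k` form a simple path. -/
def IsSimplePath {k : ℕ} (e : Fin (k + 1) → V × V) : Prop :=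
  (∀ i : Fin k, (e i.succ).1 = (e i.castSucc).2) ∧
  (∀ i j, (e i).1 = (e j).1 ∨ (e i).2 = (e j).2 → i = j) ∧
  (e 0).1 ≠ (e (Fin.last k)).2

/-- `H` is (the edge set of) a multipath of `G`: a spanning sub-graph each of whose connected
components is either a single vertex or has edges that can be ordered into a simple path. -/
def IsMultipath (G : FinDigraph V) (H : Finset (V × V)) : Prop :=
  H ⊆ G.edges ∧ ∀ v : V,
    (∀ w, Conn H v w → w = v) ∨
    ∃ (k : ℕ) (e : Fin (k + 1) → V × V), IsSimplePath e ∧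
      ∀ f : V × V, f ∈ Set.range e ↔ f ∈ H ∧ Conn H v f.1

/-- The poset `SSG(G)` of spanning sub-graphs of `G`, ordered by inclusion. -/
def spanningSubgraphs (G : FinDigraph V) : Set (Finset (V × V)) := {H | H ⊆ G.edges}

/-- The path poset `P(G)`: the multipaths of `G`, ordered by inclusion. -/
def pathPoset (G : FinDigraph V) : Set (Finset (V × V)) := {H | IsMultipath G H}

end Graphs

/-- The coherently oriented polygon `P_n` (`n ≥ 1`): vertices `v_0, …, v_n` and the `n + 1` edges
`v_0 → v_1 → ⋯ → v_n → v_0` (addition in `Fin (n + 1)` is modulo `n + 1`). -/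
def polygon (n : ℕ) (hn : 1 ≤ n) : FinDigraph (Fin (n + 1)) where
  edges := Finset.univ.image fun v : Fin (n + 1) => (v, v + 1)
  loopless := by
    intro e he h
    obtain ⟨v, -, rfl⟩ := Finset.mem_image.1 he
    have h1 : (1 : Fin (n + 1)) = 0 := by simpa using h
    have h2 := congrArg Fin.val h1
    rw [Fin.val_one', Fin.val_zero, Nat.mod_eq_of_lt (by omega)] at h2
    omega

/-! ## Components of spanning sub-graphs of an ordered digraph

The vertices are linearly ordered.  A component is labelled by its least vertex, and components are
ordered by their least vertices.  The least vertex `⊥` of all is the base vertex `v_0`. -/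

section Components

variable {V : Type*} [Fintype V] [LinearOrder V]

open Classical in
/-- The least vertex of the connected component of `v` in `H`. -/
def rep (H : Finset (V × V)) (v : V) : V :=
  (Finset.univ.filter fun w => Conn H v w).min' ⟨v, Finset.mem_filter.2 ⟨Finset.mem_univ v, Relation.EqvGen.refl v⟩⟩

/-- The position (starting from `0`) of the component of `v` among the components of `H`. -/
def index (H : Finset (V × V)) (v : V) : ℕ :=
  (Finset.univ.filter fun r => rep H r = r ∧ r < rep H v).card

/-- The sign exponent `σ(H, H ∪ e)`; `index H e.1` and `index H e.2` are the source and target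
index of `e` with respect to `H`. -/
def sigma (H : Finset (V × V)) (e : V × V) : ℕ :=
  if index H e.1 < index H e.2 then index H e.2 + 1 else index H e.1

/-- The sign exponent `ζ(H, H ∪ e)`: the number of edges of `H` preceding `e`, where edges are
ordered lexicographically by (source, target). -/
def zeta (H : Finset (V × V)) (e : V × V) : ℕ :=
  (H.filter fun f => toLex f < toLex e).card

theorem conn_rep (H : Finset (V × V)) (v : V) : Conn H v (rep H v) := by
  classical
  have := Finset.min'_mem (Finset.univ.filter fun w => Conn H v w)
    ⟨v, Finset.mem_filter.2 ⟨Finset.mem_univ v, Relation.EqvGen.refl v⟩⟩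
  simpa [rep] using this

theorem rep_le {H : Finset (V × V)} {v w : V} (h : Conn H v w) : rep H v ≤ w := by
  classical
  exact Finset.min'_le _ _ (by simpa using h)

theorem rep_eq_of_conn {H : Finset (V × V)} {v w : V} (h : Conn H v w) : rep H v = rep H w :=
  le_antisymm (rep_le (h.trans (conn_rep H w))) (rep_le (h.symm.trans (conn_rep H v)))

theorem rep_eq_iff {H : Finset (V × V)} {v w : V} : rep H v = rep H w ↔ Conn H v w :=
  ⟨fun h => (conn_rep H v).trans (h ▸ (conn_rep H w).symm), rep_eq_of_conn⟩

theorem rep_rep (H : Finset (V × V)) (v : V) : rep H (rep H v) = rep H v :=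
  (rep_eq_of_conn (conn_rep H v)).symm

theorem isRep_iff {H : Finset (V × V)} {r : V} : rep H r = r ↔ ∀ w, Conn H r w → r ≤ w :=
  ⟨fun h w hw => h ▸ rep_le hw,
    fun h => le_antisymm (rep_le (Conn.refl H r)) (h _ (conn_rep H r))⟩

theorem conn_insert {H : Finset (V × V)} {e : V × V} {a b : V} :
    Conn (insert e H) a b ↔
      Conn H a b ∨ (Conn H a e.1 ∧ Conn H e.2 b) ∨ (Conn H a e.2 ∧ Conn H e.1 b) := by
  have mono : ∀ {x y : V}, Conn H x y → Conn (insert e H) x y := fun h =>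
    Relation.EqvGen.mono (fun _ _ h => Finset.mem_insert_of_mem h) _ _ h
  have he : Conn (insert e H) e.1 e.2 := Relation.EqvGen.rel _ _ (Finset.mem_insert_self _ _)
  constructor
  · intro h
    induction h with
    | rel x y hxy =>
      rcases Finset.mem_insert.1 hxy with h | h
      · subst h; exact Or.inr (Or.inl ⟨Conn.refl _ _, Conn.refl _ _⟩)
      · exact Or.inl (Relation.EqvGen.rel _ _ h)
    | refl x => exact Or.inl (Conn.refl _ _)
    | symm x y _ ih =>
      rcases ih with h | ⟨h, h'⟩ | ⟨h, h'⟩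
      · exact Or.inl h.symm
      · exact Or.inr (Or.inr ⟨h'.symm, h.symm⟩)
      · exact Or.inr (Or.inl ⟨h'.symm, h.symm⟩)
    | trans x y z _ _ ih ih' =>
      rcases ih with h | ⟨h, h'⟩ | ⟨h, h'⟩ <;> rcases ih' with k | ⟨k, k'⟩ | ⟨k, k'⟩
      · exact Or.inl (h.trans k)
      · exact Or.inr (Or.inl ⟨h.trans k, k'⟩)
      · exact Or.inr (Or.inr ⟨h.trans k, k'⟩)
      · exact Or.inr (Or.inl ⟨h, h'.trans k⟩)
      · exact Or.inr (Or.inl ⟨h, k'⟩)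
      · exact Or.inl (h.trans k')
      · exact Or.inr (Or.inr ⟨h, h'.trans k⟩)
      · exact Or.inl (h.trans k')
      · exact Or.inr (Or.inr ⟨h, k'⟩)
  · rintro (h | ⟨h, h'⟩ | ⟨h, h'⟩)
    · exact mono h
    · exact ((mono h).trans he).trans (mono h')
    · exact ((mono h).trans he.symm).trans (mono h')

/-- If `e` joins two distinct components of `H`, then the least vertices of the components of
`H ∪ e` are those of `H`, except for the larger one of the two components which are merged. -/
theorem isRep_insert_iff {H : Finset (V × V)} {e : V × V} (he : ¬ Conn H e.1 e.2) {r : V} :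
    rep (insert e H) r = r ↔ rep H r = r ∧ r ≠ max (rep H e.1) (rep H e.2) := by
  have hne : rep H e.1 ≠ rep H e.2 := fun h => he (rep_eq_iff.1 h)
  have c1 := conn_rep H e.1
  have c2 := conn_rep H e.2
  constructor
  · intro h
    rw [isRep_iff] at h
    refine ⟨isRep_iff.2 fun _ hw => h _ (conn_insert.2 (Or.inl hw)), ?_⟩
    rintro hr
    rcases lt_or_gt_of_ne hne with hlt | hlt
    · rw [max_eq_right hlt.le] at hr
      subst hr
      exact absurd (h _ (conn_insert.2 (Or.inr (Or.inr ⟨c2.symm, c1⟩)))) (not_le.2 hlt)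
    · rw [max_eq_left hlt.le] at hr
      subst hr
      exact absurd (h _ (conn_insert.2 (Or.inr (Or.inl ⟨c1.symm, c2⟩)))) (not_le.2 hlt)
  · rintro ⟨h, hr⟩
    rw [isRep_iff]
    intro w hw
    rcases conn_insert.1 hw with k | ⟨k, k'⟩ | ⟨k, k'⟩
    · exact isRep_iff.1 h w k
    · have h1 : r = rep H e.1 := h.symm.trans (rep_eq_of_conn k)
      have : rep H e.1 < rep H e.2 := by
        rcases lt_or_gt_of_ne hne with hlt | hlt
        · exact hlt
        · rw [max_eq_left hlt.le] at hr; exact absurd h1 hr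
      rw [h1]; exact this.le.trans (rep_le k')
    · have h1 : r = rep H e.2 := h.symm.trans (rep_eq_of_conn k)
      have : rep H e.2 < rep H e.1 := by
        rcases lt_or_gt_of_ne hne with hlt | hlt
        · rw [max_eq_right hlt.le] at hr; exact absurd h1 hr
        · exact hlt
      rw [h1]; exact this.le.trans (rep_le k')

variable [OrderBot V]

/-- Labels of the components of `H` other than the component of the base vertex `⊥`. -/
abbrev Idx (H : Finset (V × V)) : Type _ := {r : V // rep H r = r ∧ r ≠ ⊥}

end Components

/-! ## Merging factors of `M ⊗ A ⊗ ⋯ ⊗ A` -/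

section Merge

variable (R A M : Type*) [CommRing R] [Ring A] [Algebra R A] [AddCommGroup M] [Module R M]
  [Module A M] [Module Aᵐᵒᵖ M] [SMulCommClass A Aᵐᵒᵖ M] [IsScalarTower R A M]
  [IsScalarTower R Aᵐᵒᵖ M]

/-- `M ⊗ ⨂_{ι} A`, tensor products over `R`. -/
abbrev TensorMod (ι : Type*) : Type _ := M ⊗[R] (⨂[R] _ : ι, A)

variable {ι κ : Type*} [DecidableEq κ]

/-- Split off the factor with label `v`: `⨂ a ↦ a v ⊗ ⨂ (a ∘ g)`, where `g` is an injection whose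
image consists of all the labels other than `v`. -/
def pluck (v : ι) (g : κ → ι) (hg : Function.Injective g) (hv : ∀ i, i ∈ Set.range g ↔ i ≠ v) :
    (⨂[R] _ : ι, A) →ₗ[R] A ⊗[R] (⨂[R] _ : κ, A) :=
  PiTensorProduct.lift
    { toFun := fun a => a v ⊗ₜ[R] PiTensorProduct.tprod R (fun k => a (g k))
      map_update_add' := by
        intro inst a i x y
        by_cases h : i = v
        · subst h
          have hk : ∀ z, (fun k => Function.update a i z (g k)) = fun k => a (g k) := fun z =>
            funext fun k => Function.update_of_ne ((hv _).1 ⟨k, rfl⟩) _ _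
          simp only [hk, Function.update_self, TensorProduct.add_tmul]
        · obtain ⟨k, rfl⟩ := (hv i).2 h
          have hk : ∀ z, (fun j => Function.update a (g k) z (g j)) =
              Function.update (fun j => a (g j)) k z := fun z =>
            Function.update_comp_eq_of_injective a hg k z
          simp only [hk, Function.update_of_ne (Ne.symm h), MultilinearMap.map_update_add,
            TensorProduct.tmul_add]
      map_update_smul' := by
        intro inst a i c x
        by_cases h : i = v
        · subst h
          have hk : ∀ z, (fun k => Function.update a i z (g k)) = fun k => a (g k) := fun z =>
            funext fun k => Function.update_of_ne ((hv _).1 ⟨k, rfl⟩) _ _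
          simp only [hk, Function.update_self, TensorProduct.smul_tmul']
        · obtain ⟨k, rfl⟩ := (hv i).2 h
          have hk : ∀ z, (fun j => Function.update a (g k) z (g j)) =
              Function.update (fun j => a (g j)) k z := fun z =>
            Function.update_comp_eq_of_injective a hg k z
          simp only [hk, Function.update_of_ne (Ne.symm h), MultilinearMap.map_update_smul,
            TensorProduct.tmul_smul] }

/-- The left action of `A` on `M`. -/
def actLeft : A →ₗ[R] M →ₗ[R] M := (Algebra.lsmul R R M).toLinearMap

/-- The right action of `A` on `M`. -/
def actRight : A →ₗ[R] M →ₗ[R] M :=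
  (Algebra.lsmul R R M : Aᵐᵒᵖ →ₐ[R] Module.End R M).toLinearMap ∘ₗ
    (MulOpposite.opLinearEquiv R : A ≃ₗ[R] Aᵐᵒᵖ).toLinearMap

/-- Let `a : A` act on `M ⊗ ⨂_κ A` through the slot `u` only: by `f a` on the factor `M` if
`u = none`, and by `g a` on the factor labelled `p` if `u = some p`. -/
def slotAct (f : A →ₗ[R] M →ₗ[R] M) (g : A →ₗ[R] A →ₗ[R] A) :
    Option κ → (A →ₗ[R] TensorMod R A M κ →ₗ[R] TensorMod R A M κ)
  | none => LinearMap.rTensorHom (⨂[R] _ : κ, A) ∘ₗ f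
  | some p => LinearMap.lTensorHom M ∘ₗ
      (PiTensorProduct.mapMultilinear R (fun _ : κ => A) (fun _ => A)).toLinearMap
        (fun _ => LinearMap.id) p ∘ₗ g

/-- Multiply the slot `u` from the left by `a`: `x_u ↦ a x_u`. -/
def slotMulLeft (u : Option κ) : A →ₗ[R] TensorMod R A M κ →ₗ[R] TensorMod R A M κ :=
  slotAct R A M (actLeft R A M) (LinearMap.mul R A) u

/-- Multiply the slot `u` from the right by `a`: `x_u ↦ x_u a`. -/
def slotMulRight (u : Option κ) : A →ₗ[R] TensorMod R A M κ →ₗ[R] TensorMod R A M κ :=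
  slotAct R A M (actRight R A M) (LinearMap.mul R A).flip u

/-- Remove the factor with label `v` and let it act on the remaining factors through `act`. -/
def absorb (v : ι) (g : κ → ι) (hg : Function.Injective g) (hv : ∀ i, i ∈ Set.range g ↔ i ≠ v)
    (act : A →ₗ[R] TensorMod R A M κ →ₗ[R] TensorMod R A M κ) :
    TensorMod R A M ι →ₗ[R] TensorMod R A M κ :=
  TensorProduct.lift act ∘ₗ (TensorProduct.leftComm R M A (⨂[R] _ : κ, A)).toLinearMap ∘ₗ
    LinearMap.lTensor M (pluck R A v g hg hv)

variable {R A M}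

theorem absorb_tmul (v : ι) (g : κ → ι) (hg : Function.Injective g)
    (hv : ∀ i, i ∈ Set.range g ↔ i ≠ v)
    (act : A →ₗ[R] TensorMod R A M κ →ₗ[R] TensorMod R A M κ) (m : M) (a : ι → A) :
    absorb R A M v g hg hv act (m ⊗ₜ PiTensorProduct.tprod R a) =
      act (a v) (m ⊗ₜ PiTensorProduct.tprod R fun k => a (g k)) := by
  simp [absorb, pluck]

theorem slotMulLeft_none (a : A) (m : M) (x : κ → A) :
    slotMulLeft R A M none a (m ⊗ₜ PiTensorProduct.tprod R x) =
      (a • m) ⊗ₜ PiTensorProduct.tprod R x := by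
  simp [slotMulLeft, slotAct, actLeft]

theorem slotMulRight_none (a : A) (m : M) (x : κ → A) :
    slotMulRight R A M none a (m ⊗ₜ PiTensorProduct.tprod R x) =
      (MulOpposite.op a • m) ⊗ₜ PiTensorProduct.tprod R x := by
  simp [slotMulRight, slotAct, actRight]

theorem slotMulLeft_some (p : κ) (a : A) (m : M) (x : κ → A) :
    slotMulLeft R A M (some p) a (m ⊗ₜ PiTensorProduct.tprod R x) =
      m ⊗ₜ PiTensorProduct.tprod R (Function.update x p (a * x p)) := by
  simp only [slotMulLeft, slotAct, LinearMap.comp_apply, LinearMap.coe_lTensorHom,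
    LinearMap.lTensor_tmul, MultilinearMap.toLinearMap_apply,
    PiTensorProduct.mapMultilinear_apply, PiTensorProduct.map_tprod]
  congr 2
  funext k
  by_cases h : k = p
  · subst h; simp
  · simp [Function.update_of_ne h]

theorem slotMulRight_some (p : κ) (a : A) (m : M) (x : κ → A) :
    slotMulRight R A M (some p) a (m ⊗ₜ PiTensorProduct.tprod R x) =
      m ⊗ₜ PiTensorProduct.tprod R (Function.update x p (x p * a)) := by
  simp only [slotMulRight, slotAct, LinearMap.comp_apply, LinearMap.coe_lTensorHom,
    LinearMap.lTensor_tmul, MultilinearMap.toLinearMap_apply,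
    PiTensorProduct.mapMultilinear_apply, PiTensorProduct.map_tprod]
  congr 2
  funext k
  by_cases h : k = p
  · subst h; simp
  · simp [Function.update_of_ne h]

end Merge

/-! ## Multipath cohomology and chromatic cohomology -/

section Cohomology

variable (R A M : Type*) [CommRing R] [Ring A] [Algebra R A] [AddCommGroup M] [Module R M]
  [Module A M] [Module Aᵐᵒᵖ M] [SMulCommClass A Aᵐᵒᵖ M] [IsScalarTower R A M]
  [IsScalarTower R Aᵐᵒᵖ M]
variable {V : Type*} [Fintype V] [LinearOrder V] [OrderBot V]

/-- `F_{A,M}(H) = M ⊗ ⨂_c A`, a factor `M` for the component of the base vertex and a factor `A`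
for every other component `c` of `H`. -/
def Coeff (H : Finset (V × V)) : Type _ := TensorMod R A M (Idx H)

instance (H : Finset (V × V)) : AddCommGroup (Coeff R A M H) :=
  inferInstanceAs (AddCommGroup (TensorMod R A M (Idx H)))

instance (H : Finset (V × V)) : Module R (Coeff R A M H) :=
  inferInstanceAs (Module R (TensorMod R A M (Idx H)))

/-- The tautological identification of `Coeff` with the tensor product it stands for. -/
def Coeff.equiv (H : Finset (V × V)) : Coeff R A M H ≃ₗ[R] TensorMod R A M (Idx H) :=
  LinearEquiv.refl R (TensorMod R A M (Idx H))

open Classical in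
/-- The map `F_{A,M}(H) → F_{A,M}(H ∪ e)`.  If `e` joins two distinct components, with factors `x`
(component of the source) and `y` (component of the target), these two factors are replaced by the
single factor `x · y`, labelled by the merged component.  (The larger of the two labels disappears
and the smaller one is the label of the merged component.)  If both ends of `e` lie in the same
component of `H`, the map is zero. -/
def edgeMap (H : Finset (V × V)) (e : V × V) :
    Coeff R A M H →ₗ[R] Coeff R A M (insert e H) :=
  if he : Conn H e.1 e.2 then 0
  else
    have hne : rep H e.1 ≠ rep H e.2 := fun h => he (rep_eq_iff.1 h)
    -- the label which disappears
    let v : Idx H := ⟨max (rep H e.1) (rep H e.2),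
      by rcases max_choice (rep H e.1) (rep H e.2) with h | h <;> rw [h] <;> exact rep_rep _ _,
      fun h => hne ((bot_unique ((le_max_left _ _).trans h.le)).trans
        (bot_unique ((le_max_right _ _).trans h.le)).symm)⟩
    let incl : Idx (insert e H) → Idx H :=
      fun r => ⟨r.1, ((isRep_insert_iff he).1 r.2.1).1, r.2.2⟩
    have hincl : Function.Injective incl := fun r s h =>
      Subtype.ext (congrArg (fun x : Idx H => x.1) h)
    have hv : ∀ i, i ∈ Set.range incl ↔ i ≠ v := fun i => by
      constructor
      · rintro ⟨r, rfl⟩ h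
        exact ((isRep_insert_iff he).1 r.2.1).2 (congrArg (fun x : Idx H => x.1) h)
      · intro h
        exact ⟨⟨i.1, (isRep_insert_iff he).2 ⟨i.2.1, fun h' => h (Subtype.ext h')⟩, i.2.2⟩, rfl⟩
    -- the slot of the merged component (`none` is the slot of `M`)
    let u : Option (Idx (insert e H)) :=
      if hu : min (rep H e.1) (rep H e.2) = ⊥ then none
      else some ⟨min (rep H e.1) (rep H e.2), (isRep_insert_iff he).2
        ⟨by rcases min_choice (rep H e.1) (rep H e.2) with h | h <;> rw [h] <;> exact rep_rep _ _,
          (min_lt_max.2 hne).ne⟩, hu⟩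
    (Coeff.equiv R A M (insert e H)).symm.toLinearMap ∘ₗ
      absorb R A M v incl hincl hv
        (if rep H e.1 < rep H e.2 then slotMulRight R A M u else slotMulLeft R A M u) ∘ₗ
      (Coeff.equiv R A M H).toLinearMap

/-- `C^i(P) = ⨁ F_{A,M}(H)` over all `H` in the poset `P` of spanning sub-graphs with `i` edges. -/
abbrev Cochain (P : Set (Finset (V × V))) (i : ℕ) : Type _ :=
  ⨁ H : {H : Finset (V × V) // H ∈ P ∧ H.card = i}, Coeff R A M H.1

open Classical in
/-- The differential `d^i : C^i(P) → C^{i+1}(P)` with sign exponents `ε`: on `F_{A,M}(H)` it is the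
sum of `(-1)^{ε(H, H ∪ e)} F_{A,M}(H ≺ H ∪ e)` over all edges `e ∉ H` with `H ∪ e ∈ P`. -/
def diff (P : Set (Finset (V × V))) (ε : Finset (V × V) → V × V → ℕ) (i : ℕ) :
    Cochain R A M P i →ₗ[R] Cochain R A M P (i + 1) :=
  DirectSum.toModule R _ _ fun H =>
    ∑ e : V × V,
      if h : e ∉ H.1 ∧ insert e H.1 ∈ P then
        ((-1 : R) ^ ε H.1 e) •
          (DirectSum.lof R {H' : Finset (V × V) // H' ∈ P ∧ H'.card = i + 1}
            (fun H' => Coeff R A M H'.1)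
            ⟨insert e H.1, h.2, by rw [Finset.card_insert_of_notMem h.1, H.2.2]⟩ ∘ₗ
          edgeMap R A M H.1 e)
      else 0

/-- The coboundaries in degree `i`: the image of `d^{i-1}` (zero for `i = 0`). -/
def coboundaries (P : Set (Finset (V × V))) (ε : Finset (V × V) → V × V → ℕ) :
    (i : ℕ) → Submodule R (Cochain R A M P i)
  | 0 => ⊥
  | i + 1 => LinearMap.range (diff R A M P ε i)

/-- `H^i = ker d^i / im d^{i-1}`. -/
abbrev Cohomology (P : Set (Finset (V × V))) (ε : Finset (V × V) → V × V → ℕ) (i : ℕ) : Type _ :=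
  LinearMap.ker (diff R A M P ε i) ⧸
    (coboundaries R A M P ε i).submoduleOf (LinearMap.ker (diff R A M P ε i))

/-- Multipath cohomology `H^i_μ(G; A, M)` of an ordered digraph. -/
abbrev MultipathCohomology (G : FinDigraph V) (i : ℕ) : Type _ :=
  Cohomology R A M (pathPoset G) sigma i

/-- Przytycki's variant `Ĥ^i_Chrom(G; A, M)` of chromatic homology: the sum is over all spanning
sub-graphs, and edges with both ends in one component induce the zero map.  Products are taken
in the order given by the orientation of the edges; for coherently oriented lines and polygons this
is the extension to non-commutative algebras. -/
abbrev ChromaticCohomology (G : FinDigraph V) (i : ℕ) : Type _ :=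
  Cohomology R A M (spanningSubgraphs G) zeta i

/-! ## Hochschild homology -/

/-- Hochschild chains `M ⊗ A^{⊗ k}`. -/
abbrev HChain (k : ℕ) : Type _ := TensorMod R A M (Fin k)

/-- The slot preceding the `j`-th factor `A` (counting from `0`): `M` for `j = 0`. -/
def prevSlot {k : ℕ} (j : Fin (k + 1)) : Option (Fin k) :=
  if h : j.1 = 0 then none else some ⟨j.1 - 1, by have := j.2; omega⟩

theorem range_succAbove_iff {k : ℕ} (j i : Fin (k + 1)) :
    i ∈ Set.range j.succAbove ↔ i ≠ j := by
  rw [Fin.range_succAbove]; simp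

/-- For `j = 0, …, k`, the face `d_j : M ⊗ A^{⊗(k+1)} → M ⊗ A^{⊗k}`, which multiplies the `j`-th
and the `(j+1)`-st factor of `(m, a_1, …, a_{k+1})`: `d_0 = (m a_1, a_2, …, a_{k+1})` and
`d_j = (m, a_1, …, a_j a_{j+1}, …, a_{k+1})` for `j ≥ 1`. -/
def hface {k : ℕ} (j : Fin (k + 1)) : HChain R A M (k + 1) →ₗ[R] HChain R A M k :=
  absorb R A M j j.succAbove j.succAbove_right_injective (range_succAbove_iff j)
    (slotMulRight R A M (prevSlot j))

/-- The last face `d_{k+1} (m, a_1, …, a_{k+1}) = (a_{k+1} m, a_1, …, a_k)`. -/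
def hfaceLast (k : ℕ) : HChain R A M (k + 1) →ₗ[R] HChain R A M k :=
  absorb R A M (Fin.last k) (Fin.last k).succAbove (Fin.last k).succAbove_right_injective
    (range_succAbove_iff _) (slotMulLeft R A M none)

/-- The Hochschild boundary `b = ∑_{j=0}^{k+1} (-1)^j d_j : M ⊗ A^{⊗(k+1)} → M ⊗ A^{⊗k}`. -/
def hboundary (k : ℕ) : HChain R A M (k + 1) →ₗ[R] HChain R A M k :=
  ∑ j : Fin (k + 1), ((-1 : R) ^ j.1) • hface R A M j + ((-1 : R) ^ (k + 1)) • hfaceLast R A M k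

/-- The Hochschild cycles in degree `k` (everything in degree `0`). -/
def hcycles : (k : ℕ) → Submodule R (HChain R A M k)
  | 0 => ⊤
  | k + 1 => LinearMap.ker (hboundary R A M k)

/-- Hochschild homology `HH_k(A, M)` of the `R`-algebra `A` with coefficients in `M`. -/
abbrev HochschildHomology (k : ℕ) : Type _ :=
  hcycles R A M k ⧸ (LinearMap.range (hboundary R A M k)).submoduleOf (hcycles R A M k)

variable {R A M}

theorem hface_zero_tmul {k : ℕ} (m : M) (a : Fin (k + 1) → A) :
    hface R A M (0 : Fin (k + 1)) (m ⊗ₜ PiTensorProduct.tprod R a) =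
      (MulOpposite.op (a 0) • m) ⊗ₜ PiTensorProduct.tprod R (Fin.tail a) := by
  have hp : prevSlot (0 : Fin (k + 1)) = none := by simp [prevSlot]
  simp only [hface, absorb_tmul, hp, slotMulRight_none]
  rfl

theorem hface_succ_tmul {k : ℕ} (j : Fin k) (m : M) (a : Fin (k + 1) → A) :
    hface R A M j.succ (m ⊗ₜ PiTensorProduct.tprod R a) =
      m ⊗ₜ PiTensorProduct.tprod R (Fin.contractNth j.castSucc (· * ·) a) := by
  have hp : prevSlot j.succ = some j := by simp [prevSlot]
  simp only [hface, absorb_tmul, hp, slotMulRight_some]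
  congr 2
  funext i
  rcases lt_trichotomy i j with h | h | h
  · rw [Function.update_of_ne h.ne, Fin.contractNth_apply_of_lt _ _ _ _ (by simpa using h),
      Fin.succAbove_of_castSucc_lt _ _ (by
        rw [Fin.lt_def] at h ⊢; simp only [Fin.val_castSucc, Fin.val_succ]; omega)]
  · subst h
    rw [Function.update_self, Fin.contractNth_apply_of_eq _ _ _ _ (by simp),
      Fin.succAbove_of_castSucc_lt _ _ (by
        rw [Fin.lt_def]; simp)]
  · rw [Function.update_of_ne h.ne', Fin.contractNth_apply_of_gt _ _ _ _ (by simpa using h),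
      Fin.succAbove_of_le_castSucc _ _ (by
        rw [Fin.lt_def] at h; rw [Fin.le_def]; simp only [Fin.val_castSucc, Fin.val_succ]; omega)]

theorem hfaceLast_tmul (k : ℕ) (m : M) (a : Fin (k + 1) → A) :
    hfaceLast R A M k (m ⊗ₜ PiTensorProduct.tprod R a) =
      (a (Fin.last k) • m) ⊗ₜ PiTensorProduct.tprod R (Fin.init a) := by
  simp only [hfaceLast, absorb_tmul, slotMulLeft_none, Fin.succAbove_last]
  rfl

end Cohomology

end MultipathHH

end

/-! A spanning sub-graph of the polygon is determined by its set `S` of cuts, the vertices whose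
outgoing edge is missing. If `S` has `k + 1 ≥ 1` elements, the sub-graph consists of `k + 1`
cyclically ordered arcs and its coefficient module is `X_k = M ⊗ A^{⊗k}`. Restoring the edge at the
cut in position `j` of `S` multiplies two neighbouring factors: it is the Hochschild face `d_j`, the
last face arising when the last arc is joined to the arc of `v_0`. So, up to equivalent signs, both
cochain complexes are, in degrees up to `n`, the chains on the simplex with vertices `0, …, n`,
where a face with `k + 1` vertices carries coefficients in the simplicial module `X` and cochain
degree `i` becomes `k = n - i`. The full polygon, present only in the chromatic complex, has no
influence: the maps into it come from connected sub-graphs and vanish.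

It remains to compare chains on the simplex with `(X, b)`. Adding up the values over all faces is a
chain map (`b_total`), and it is bijective on homology for `k < n`. For this, let `s_p` together
with the addition of the vertex `p` act as a homotopy, for `p = 0, …, k` in turn. Each step forces
the support to contain `p` and kills the face `d_p`. In the end a cycle lives on the initial face
`{0, …, k}` alone, with a value in the Moore complex, where every face but the last vanishes
(`exists_reduce`). The same degeneracies, without the simplex, show that the Moore complex computes
the homology of `(X, b)` (`exists_vanish`). A Moore element placed on an initial face has its
boundary on the next smaller initial face (`bdry_single`), which matches the two sides. Bounding a
`k`-cycle requires an initial face with `k + 2` vertices, hence `k < n`, that is `i ≥ 1`. -/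

open scoped TensorProduct DirectSum

noncomputable section

namespace MultipathHH

/-! ## Simplicial modules -/

/-- Faces and degeneracies satisfying those simplicial identities which involve a face. -/
structure FaceDegeneracy (R : Type*) [CommRing R] (X : ℕ → Type*) [∀ k, AddCommGroup (X k)]
    [∀ k, Module R (X k)] where
  d : ∀ k, ℕ → X (k + 1) →ₗ[R] X k
  s : ∀ k, ℕ → X k →ₗ[R] X (k + 1)
  d_d : ∀ k i j x, i ≤ j → j ≤ k + 1 → d k i (d (k + 1) (j + 1) x) = d k j (d (k + 1) i x)
  d_s_self : ∀ k p x, p ≤ k → d k p (s k p x) = x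
  d_s_succ : ∀ k p x, p ≤ k → d k (p + 1) (s k p x) = x
  d_s_lt : ∀ k i p x, i ≤ p → p ≤ k → d (k + 1) i (s (k + 1) (p + 1) x) = s k p (d k i x)
  d_s_gt : ∀ k i p x, p < i → i ≤ k + 1 → d (k + 1) (i + 1) (s (k + 1) p x) = s k p (d k i x)

namespace FaceDegeneracy

variable {R : Type*} [CommRing R] {X : ℕ → Type*} [∀ k, AddCommGroup (X k)]
  [∀ k, Module R (X k)] (D : FaceDegeneracy R X)

/-- The alternating sum of the faces. -/
def b (k : ℕ) : X (k + 1) →ₗ[R] X k := ∑ j ∈ Finset.range (k + 2), (-1 : R) ^ j • D.d k j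

theorem b_apply (k : ℕ) (x : X (k + 1)) :
    D.b k x = ∑ j ∈ Finset.range (k + 2), (-1 : R) ^ j • D.d k j x := by
  simp [b, LinearMap.sum_apply]

/-- All faces `d_i` with `i < p`, except for the last one, vanish on `x`. -/
def Vanish : ∀ k : ℕ, ℕ → X k → Prop
  | 0, _, _ => True
  | k + 1, p, x => ∀ i < p, i ≤ k → D.d k i x = 0

theorem b_b (k : ℕ) (x : X (k + 2)) : D.b k (D.b (k + 1) x) = 0 := by
  simp only [b_apply, map_sum, map_smul, Finset.smul_sum, smul_smul]
  rw [Finset.sum_sigma']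
  refine Finset.sum_involution
    -- The term `d_i d_j` with `i < j` is matched with `d_{j-1} d_i`. The two agree by the
    -- simplicial identity, and their signs are opposite.
    (fun q _ => if q.2 < q.1 then ⟨q.2, q.1 - 1⟩ else ⟨q.2 + 1, q.1⟩) ?_ ?_ ?_ ?_
  · rintro ⟨j, i⟩ h
    simp only [Finset.mem_sigma, Finset.mem_range] at h
    by_cases hij : i < j
    · obtain ⟨j, rfl⟩ : ∃ j', j = j' + 1 := ⟨j - 1, by omega⟩
      simp only [hij, if_true, Nat.add_sub_cancel, D.d_d k i j x (by omega) (by omega)]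
      rw [← Module.add_smul]
      have : (-1 : R) ^ (j + 1) * (-1) ^ i + (-1) ^ i * (-1) ^ j = 0 := by ring
      rw [this, zero_smul]
    · simp only [hij, if_false, D.d_d k j i x (by omega) (by omega)]
      rw [← Module.add_smul]
      have : (-1 : R) ^ j * (-1) ^ i + (-1) ^ (i + 1) * (-1) ^ j = 0 := by ring
      rw [this, zero_smul]
  · rintro ⟨j, i⟩ h _
    by_cases hij : i < j
    · simp only [hij, if_true, ne_eq, Sigma.mk.injEq, not_and]
      intro h1
      omega
    · simp only [hij, if_false, ne_eq, Sigma.mk.injEq, not_and]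
      intro h1
      omega
  · rintro ⟨j, i⟩ h
    simp only [Finset.mem_sigma, Finset.mem_range] at h ⊢
    split_ifs <;> constructor <;> simp only <;> omega
  · rintro ⟨j, i⟩ h
    by_cases hij : i < j
    · have h1 : ¬ (j - 1 < i) := by omega
      simp only [hij, if_true, h1, if_false]
      rw [Nat.sub_add_cancel (by omega)]
    · have h1 : j < i + 1 := by omega
      simp only [hij, if_true, h1, if_false, Nat.add_sub_cancel]

theorem d_s_eq_zero {k p i : ℕ} (x : X k) (h : D.Vanish k p x) (hp : p ≤ k) (hi : i < p) :
    D.d k i (D.s k p x) = 0 := by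
  obtain _ | p := p
  · omega
  obtain _ | k := k
  · omega
  rw [D.d_s_lt k i p x (by omega) (by omega), h i hi (by omega), map_zero]

/-- Faces of `s_p x` below `p` vanish, the faces `p` and `p + 1` both give `x` and cancel, and the
higher ones pass through `s_p` with an index shift that reverses the sign. Thus, where the first `p`
faces vanish, `(-1)^p s_p` is a homotopy between `s_p d_p` and zero. -/
theorem b_s {k p : ℕ} (x : X (k + 1)) (h : D.Vanish (k + 1) p x) (hp : p ≤ k) :
    D.b (k + 1) (D.s (k + 1) p x) = (-1 : R) ^ p • D.s k p (D.d k p x) - D.s k p (D.b k x) := by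
  have e1 : D.b k x = ∑ j ∈ Finset.range (k + 2), (-1 : R) ^ j • D.d k j x := D.b_apply k x
  obtain ⟨q, rfl⟩ : ∃ q, k = p + q := ⟨k - p, by omega⟩
  have z : ∀ i ∈ Finset.range p, (-1 : R) ^ i • D.d (p + q) i x = 0 := fun i hi => by
    rw [h i (Finset.mem_range.1 hi) (by have := Finset.mem_range.1 hi; omega), smul_zero]
  have z' : ∀ i ∈ Finset.range p,
      (-1 : R) ^ i • D.d (p + q + 1) i (D.s (p + q + 1) p x) = 0 := fun i hi => by
    rw [D.d_s_eq_zero x h (by omega) (Finset.mem_range.1 hi), smul_zero]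
  rw [b_apply, show Finset.range (p + q + 1 + 2) = Finset.range (p + (q + 1 + 1 + 1)) from rfl, Finset.sum_range_add,
    Finset.sum_eq_zero z', b_apply, show Finset.range (p + q + 2) = Finset.range (p + (q + 1 + 1)) from rfl,
    Finset.sum_range_add _ p, Finset.sum_eq_zero z, Finset.sum_range_succ', Finset.sum_range_succ',
    Finset.sum_range_succ' _ (q + 1)]
  have e2 : ∀ i ∈ Finset.range (q + 1),
      (-1 : R) ^ (p + (i + 1 + 1)) • D.d (p + q + 1) (p + (i + 1 + 1)) (D.s (p + q + 1) p x) =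
      - D.s (p + q) p ((-1 : R) ^ (p + (i + 1)) • D.d (p + q) (p + (i + 1)) x) := fun i hi => by
    have := Finset.mem_range.1 hi
    rw [show p + (i + 1 + 1) = p + (i + 1) + 1 by ring,
      D.d_s_gt (p + q) (p + (i + 1)) p x (by omega) (by omega), map_smul, pow_succ]
    simp
  rw [Finset.sum_congr rfl e2, Finset.sum_neg_distrib, map_add, map_add, map_sum]
  simp only [add_zero, zero_add]
  rw [D.d_s_self _ _ _ (by omega), D.d_s_succ _ _ _ (by omega), pow_succ]
  simp only [map_zero, map_smul, mul_neg, mul_one, neg_smul]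
  abel

theorem b_s_last {k : ℕ} (x : X k) (h : D.Vanish k k x) : D.b k (D.s k k x) = 0 := by
  have z' : ∀ i ∈ Finset.range k, (-1 : R) ^ i • D.d k i (D.s k k x) = 0 := fun i hi => by
    rw [D.d_s_eq_zero x h le_rfl (Finset.mem_range.1 hi), smul_zero]
  rw [b_apply, Finset.sum_range_succ, Finset.sum_range_succ, Finset.sum_eq_zero z',
    D.d_s_self _ _ _ le_rfl, D.d_s_succ _ _ _ le_rfl, pow_succ]
  simp

/-- This is the error term in the boundary of the corrected element in `exists_vanish_step`. For `p
< k` both terms of `b_s` vanish; for `p = k` only the two cancelling faces of `s_k` are left. -/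
theorem b_s_b_eq_zero {k p : ℕ} (w : X (k + 1)) (h : D.Vanish k k (D.b k w)) (hp : p ≤ k) :
    D.b k (D.s k p (D.b k w)) = 0 := by
  obtain rfl | hlt := hp.eq_or_lt
  · exact D.b_s_last _ h
  obtain _ | k := k
  · omega
  rw [D.b_s _ (fun i hi hi' => h i (by omega) hi') (by omega), h p (by omega) (by omega), D.b_b]
  simp

/-- The correction is `w' = w - s_p d_p w`: since `d_p s_p = 1` it kills `d_p`, and by `b_s` it
changes `w` only by a boundary and a multiple of `s_p b w`. -/
theorem exists_vanish_step {k p : ℕ} (hp : p ≤ k) (w : X (k + 1)) (h : D.Vanish (k + 1) p w)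
    (hb : D.Vanish k k (D.b k w)) :
    ∃ w', D.Vanish (k + 1) (p + 1) w' ∧ D.b k w' = D.b k w ∧
      (D.b k w = 0 → w - w' ∈ LinearMap.range (D.b (k + 1))) := by
  have e := D.b_s w h hp
  have hsq : (-1 : R) ^ p * (-1) ^ p = 1 := by
    rw [← mul_pow]; simp
  have e' : w - D.s k p (D.d k p w) =
      w - (-1 : R) ^ p • D.b (k + 1) (D.s (k + 1) p w) - (-1 : R) ^ p • D.s k p (D.b k w) := by
    rw [e, smul_sub, smul_smul, hsq, one_smul]; abel
  refine ⟨w - D.s k p (D.d k p w), ?_, ?_, ?_⟩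
  · intro i hi hi'
    obtain rfl | hlt := (Nat.lt_succ_iff.1 hi).eq_or_lt
    · rw [map_sub, D.d_s_self _ _ _ hp, sub_self]
    · have : D.Vanish k p (D.d k p w) := by
        obtain _ | k := k
        · trivial
        intro j hj hj'
        obtain ⟨p, rfl⟩ : ∃ p', p = p' + 1 := ⟨p - 1, by omega⟩
        rw [D.d_d _ _ _ _ (by omega) (by omega), h j hj (by omega), map_zero]
      rw [map_sub, h i hlt hi', D.d_s_eq_zero _ this hp hlt, sub_zero]
  · rw [e', map_sub, map_sub, map_smul, map_smul, D.b_b, D.b_s_b_eq_zero _ hb hp]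
    simp
  · intro h0
    refine ⟨(-1 : R) ^ p • D.s (k + 1) p w, ?_⟩
    rw [e', h0, map_smul]
    simp

/-- Passing to the Moore complex does not change homology. -/
theorem exists_vanish {k : ℕ} (w : X (k + 1)) (hb : D.Vanish k k (D.b k w)) :
    ∃ w', D.Vanish (k + 1) (k + 1) w' ∧ D.b k w' = D.b k w ∧
      (D.b k w = 0 → w - w' ∈ LinearMap.range (D.b (k + 1))) := by
  -- The faces are killed one at a time. Every step keeps the boundary, so the Moore condition on `b
  -- w` is available throughout, also when `w` is not a cycle.
  suffices H : ∀ p ≤ k + 1, ∃ w', D.Vanish (k + 1) p w' ∧ D.b k w' = D.b k w ∧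
      (D.b k w = 0 → w - w' ∈ LinearMap.range (D.b (k + 1))) from H _ le_rfl
  intro p
  induction p with
  | zero => exact fun _ => ⟨w, fun i hi => by omega, rfl, fun _ => by simp⟩
  | succ p ih =>
    intro hp
    obtain ⟨w₁, h1, h2, h3⟩ := ih (by omega)
    obtain ⟨w₂, h4, h5, h6⟩ := D.exists_vanish_step (by omega) w₁ h1 (h2 ▸ hb)
    refine ⟨w₂, h4, h5.trans h2, fun h0 => ?_⟩
    have := Submodule.add_mem _ (h3 h0) (h6 (h2.trans h0))
    rwa [sub_add_sub_cancel] at this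

end FaceDegeneracy

/-! ## The simplicial module of Hochschild chains -/

section Hochschild

variable (R A M : Type*) [CommRing R] [Ring A] [Algebra R A] [AddCommGroup M] [Module R M]
  [Module A M] [Module Aᵐᵒᵖ M] [SMulCommClass A Aᵐᵒᵖ M] [IsScalarTower R A M]
  [IsScalarTower R Aᵐᵒᵖ M]

/-- The faces of Hochschild chains, indexed by natural numbers. -/
def hd (k j : ℕ) : HChain R A M (k + 1) →ₗ[R] HChain R A M k :=
  if h : j < k + 1 then hface R A M ⟨j, h⟩ else hfaceLast R A M k

/-- The degeneracy `s_p`, which inserts `1` after the first `p` factors `A`. -/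
def hs (k p : ℕ) : HChain R A M k →ₗ[R] HChain R A M (k + 1) :=
  if h : p < k + 1 then
    LinearMap.lTensor M (PiTensorProduct.lift ((PiTensorProduct.tprod R (s := fun _ : Fin (k + 1) => A)).curryMid ⟨p, h⟩ 1))
  else 0

variable {A M}

/-- The pure tensor `m ⊗ a 0 ⊗ ⋯ ⊗ a (k - 1)`. -/
def hpure (k : ℕ) (m : M) (a : ℕ → A) : HChain R A M k :=
  m ⊗ₜ PiTensorProduct.tprod R fun i : Fin k => a i

variable {R}

theorem hpure_congr {k : ℕ} {m m' : M} {a a' : ℕ → A} (h : m = m') (h' : ∀ i < k, a i = a' i) :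
    hpure R k m a = hpure R k m' a' := by
  subst h
  unfold hpure
  congr 2
  exact funext fun i => h' i i.2

theorem tensorMod_ext {ι N : Type*} [AddCommGroup N] [Module R N]
    {f g : TensorMod R A M ι →ₗ[R] N}
    (h : ∀ (m : M) (a : ι → A), f (m ⊗ₜ PiTensorProduct.tprod R a) =
      g (m ⊗ₜ PiTensorProduct.tprod R a)) : f = g := by
  refine TensorProduct.ext' fun m x => ?_
  induction x using PiTensorProduct.induction_on with
  | smul_tprod r a => rw [TensorProduct.tmul_smul, map_smul, map_smul, h]
  | add x y hx hy => rw [TensorProduct.tmul_add, map_add, map_add, hx, hy]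

/-- Testing on sequences indexed by `ℕ` makes faces and degeneracies case distinctions on natural
numbers. Entries from `k` on are irrelevant, whence the filler `0` below. -/
theorem hchain_ext {k : ℕ} {N : Type*} [AddCommGroup N] [Module R N] {f g : HChain R A M k →ₗ[R] N}
    (h : ∀ m a, f (hpure R k m a) = g (hpure R k m a)) : f = g := by
  refine tensorMod_ext fun m a => ?_
  have e : m ⊗ₜ PiTensorProduct.tprod R a =
      hpure R k m fun i => if h : i < k then a ⟨i, h⟩ else 0 := by
    unfold hpure
    congr 2
    funext i
    simp
  rw [e, h]

/-- The factor `M` of the `j`-th face. -/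
def faceM (k j : ℕ) (m : M) (a : ℕ → A) : M :=
  if j = k + 1 then a k • m else if j = 0 then MulOpposite.op (a 0) • m else m

/-- The factors `A` of the `j`-th face. -/
def faceA (j : ℕ) (a : ℕ → A) (i : ℕ) : A :=
  if i + 1 < j then a i else if i + 1 = j then a i * a (i + 1) else a (i + 1)

/-- The factors `A` of the `p`-th degeneracy. -/
def degenA (p : ℕ) (a : ℕ → A) (i : ℕ) : A :=
  if i < p then a i else if i = p then 1 else a (i - 1)

theorem hd_hpure (k j : ℕ) (hj : j ≤ k + 1) (m : M) (a : ℕ → A) :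
    hd R A M k j (hpure R (k + 1) m a) = hpure R k (faceM k j m a) (faceA j a) := by
  unfold hd
  split_ifs with h
  · obtain _ | j := j
    · refine (hface_zero_tmul m _).trans ?_
      unfold hpure
      congr 1
    · refine (hface_succ_tmul ⟨j, by omega⟩ m _).trans ?_
      unfold hpure
      congr 1
      · rw [faceM, if_neg (by omega), if_neg (by omega)]
      · congr 1
        funext i
        simp only [Fin.contractNth, faceA, Fin.castSucc_mk, Fin.val_castSucc, Fin.val_succ]
        split_ifs <;> first | rfl | omega
  · obtain rfl : j = k + 1 := by omega
    refine (hfaceLast_tmul k m _).trans ?_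
    unfold hpure
    congr 1
    · simp [faceM]
    · congr 1
      funext i
      simp [faceA, Fin.init]

theorem hs_hpure (k p : ℕ) (hp : p ≤ k) (m : M) (a : ℕ → A) :
    hs R A M k p (hpure R k m a) = hpure R (k + 1) m (degenA p a) := by
  unfold hs
  rw [dif_pos (by omega)]
  unfold hpure
  rw [LinearMap.lTensor_tmul, PiTensorProduct.lift.tprod]
  congr 1
  change PiTensorProduct.tprod R (Fin.insertNth _ _ _) = _
  congr 1
  funext i
  refine Fin.succAboveCases (⟨p, by omega⟩ : Fin (k + 1)) ?_ (fun j => ?_) i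
  · simp [degenA]
  · rw [Fin.insertNth_apply_succAbove]
    by_cases h : j.1 < p
    · rw [Fin.succAbove_of_castSucc_lt _ _ (by simpa [Fin.lt_def] using h)]
      simp [degenA, h]
    · rw [Fin.succAbove_of_le_castSucc _ _ (by simpa [Fin.le_def] using h)]
      have h1 : ¬ (j.1 + 1 < p) := by omega
      have h2 : ¬ (j.1 + 1 = p) := by omega
      simp [degenA, h1, h2]

-- On the factor `M` the identities express associativity of the right action (`i = j = 0`),
-- associativity of the left action (`i = j = k + 1`), and commutation of the two actions (`i = 0`,
-- `j = k + 1`).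
omit [Algebra R A] [Module R M] [IsScalarTower R A M] [IsScalarTower R Aᵐᵒᵖ M] in
theorem faceM_faceM (k i j : ℕ) (hij : i ≤ j) (hj : j ≤ k + 1) (m : M) (a : ℕ → A) :
    faceM k i (faceM (k + 1) (j + 1) m a) (faceA (j + 1) a) =
      faceM k j (faceM (k + 1) i m a) (faceA i a) := by
  by_cases hjk : j = k + 1
  · subst hjk
    by_cases hi : i = k + 1
    · subst hi
      simp [faceM, faceA, mul_smul]
    · by_cases hi0 : i = 0
      · subst hi0
        simp [faceM, faceA, smul_comm]
      · have h1 : ¬ k + 1 < i := by omega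
        have h2 : ¬ i = k + 2 := by omega
        have h3 : ¬ k + 1 = i := by omega
        simp [faceM, faceA, h1, hi, hi0, h2, h3]
  · have hi : ¬ i = k + 1 := by omega
    have hi' : ¬ i = k + 2 := by omega
    by_cases hi0 : i = 0
    · subst hi0
      by_cases hj0 : j = 0
      · subst hj0
        simp [faceM, faceA, mul_smul]
      · have : 0 < j := by omega
        simp [faceM, faceA, hjk, hj0, this]
    · have hj0 : ¬ j = 0 := by omega
      simp [faceM, hi, hi', hi0, hjk, hj0]

omit [Algebra R A] [AddCommGroup M] [Module R M] [Module A M] [Module Aᵐᵒᵖ M]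
  [SMulCommClass A Aᵐᵒᵖ M] [IsScalarTower R A M] [IsScalarTower R Aᵐᵒᵖ M] in
theorem faceA_faceA (i j : ℕ) (hij : i ≤ j) (a : ℕ → A) (l : ℕ) :
    faceA i (faceA (j + 1) a) l = faceA j (faceA i a) l := by
  unfold faceA
  grind [mul_assoc]

omit [Algebra R A] [Module R M] [IsScalarTower R A M] [IsScalarTower R Aᵐᵒᵖ M]
  [SMulCommClass A Aᵐᵒᵖ M] in
theorem faceM_degen_self (k p : ℕ) (hp : p ≤ k) (m : M) (a : ℕ → A) :
    faceM k p m (degenA p a) = m := by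
  unfold faceM degenA
  grind [one_smul, MulOpposite.op_one]

omit [Algebra R A] [AddCommGroup M] [Module R M] [Module A M] [Module Aᵐᵒᵖ M]
  [SMulCommClass A Aᵐᵒᵖ M] [IsScalarTower R A M] [IsScalarTower R Aᵐᵒᵖ M] in
theorem faceA_degen_self (p : ℕ) (a : ℕ → A) (l : ℕ) :
    faceA p (degenA p a) l = a l := by
  unfold faceA degenA
  grind [mul_one, one_mul]

omit [Algebra R A] [Module R M] [IsScalarTower R A M] [IsScalarTower R Aᵐᵒᵖ M]
  [SMulCommClass A Aᵐᵒᵖ M] in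
theorem faceM_degen_succ (k p : ℕ) (hp : p ≤ k) (m : M) (a : ℕ → A) :
    faceM k (p + 1) m (degenA p a) = m := by
  unfold faceM degenA
  grind [one_smul, MulOpposite.op_one]

omit [Algebra R A] [AddCommGroup M] [Module R M] [Module A M] [Module Aᵐᵒᵖ M]
  [SMulCommClass A Aᵐᵒᵖ M] [IsScalarTower R A M] [IsScalarTower R Aᵐᵒᵖ M] in
theorem faceA_degen_succ (p : ℕ) (a : ℕ → A) (l : ℕ) :
    faceA (p + 1) (degenA p a) l = a l := by
  unfold faceA degenA
  grind [mul_one, one_mul]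

omit [Algebra R A] [Module R M] [IsScalarTower R A M] [IsScalarTower R Aᵐᵒᵖ M]
  [SMulCommClass A Aᵐᵒᵖ M] in
theorem faceM_degen_lt (k i p : ℕ) (hi : i ≤ p) (hp : p ≤ k) (m : M) (a : ℕ → A) :
    faceM (k + 1) i m (degenA (p + 1) a) = faceM k i m a := by
  unfold faceM degenA
  grind [one_smul, MulOpposite.op_one]

omit [Algebra R A] [AddCommGroup M] [Module R M] [Module A M] [Module Aᵐᵒᵖ M]
  [SMulCommClass A Aᵐᵒᵖ M] [IsScalarTower R A M] [IsScalarTower R Aᵐᵒᵖ M] in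
theorem faceA_degen_lt (i p : ℕ) (hi : i ≤ p) (a : ℕ → A) (l : ℕ) :
    faceA i (degenA (p + 1) a) l = degenA p (faceA i a) l := by
  unfold faceA degenA
  grind

omit [Algebra R A] [Module R M] [IsScalarTower R A M] [IsScalarTower R Aᵐᵒᵖ M]
  [SMulCommClass A Aᵐᵒᵖ M] in
theorem faceM_degen_gt (k i p : ℕ) (hi : p < i) (hi' : i ≤ k + 1) (m : M) (a : ℕ → A) :
    faceM (k + 1) (i + 1) m (degenA p a) = faceM k i m a := by
  unfold faceM degenA
  grind [one_smul, MulOpposite.op_one]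

omit [Algebra R A] [AddCommGroup M] [Module R M] [Module A M] [Module Aᵐᵒᵖ M]
  [SMulCommClass A Aᵐᵒᵖ M] [IsScalarTower R A M] [IsScalarTower R Aᵐᵒᵖ M] in
theorem faceA_degen_gt (i p : ℕ) (hi : p < i) (a : ℕ → A) (l : ℕ) :
    faceA (i + 1) (degenA p a) l = degenA p (faceA i a) l := by
  unfold faceA degenA
  grind

variable (R A M)

/-- Hochschild chains form a simplicial module. -/
def hochschild : FaceDegeneracy R (HChain R A M) where
  d := hd R A M
  s := hs R A M
  d_d k i j x hij hj := by
    refine LinearMap.congr_fun (f := hd R A M k i ∘ₗ hd R A M (k + 1) (j + 1))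
      (g := hd R A M k j ∘ₗ hd R A M (k + 1) i) (hchain_ext fun m a => ?_) x
    simp only [LinearMap.comp_apply]
    rw [hd_hpure _ _ (by omega), hd_hpure _ _ (by omega), hd_hpure _ _ (by omega),
      hd_hpure _ _ (by omega)]
    exact hpure_congr (faceM_faceM k i j hij hj m a) fun l _ => faceA_faceA i j hij a l
  d_s_self k p x hp := by
    refine LinearMap.congr_fun (f := hd R A M k p ∘ₗ hs R A M k p)
      (g := LinearMap.id) (hchain_ext fun m a => ?_) x
    simp only [LinearMap.comp_apply, LinearMap.id_apply]
    rw [hs_hpure _ _ hp, hd_hpure _ _ (by omega)]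
    exact hpure_congr (faceM_degen_self k p hp m a) fun l _ => faceA_degen_self p a l
  d_s_succ k p x hp := by
    refine LinearMap.congr_fun (f := hd R A M k (p + 1) ∘ₗ hs R A M k p)
      (g := LinearMap.id) (hchain_ext fun m a => ?_) x
    simp only [LinearMap.comp_apply, LinearMap.id_apply]
    rw [hs_hpure _ _ hp, hd_hpure _ _ (by omega)]
    exact hpure_congr (faceM_degen_succ k p hp m a) fun l _ => faceA_degen_succ p a l
  d_s_lt k i p x hi hp := by
    refine LinearMap.congr_fun (f := hd R A M (k + 1) i ∘ₗ hs R A M (k + 1) (p + 1))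
      (g := hs R A M k p ∘ₗ hd R A M k i) (hchain_ext fun m a => ?_) x
    simp only [LinearMap.comp_apply]
    rw [hs_hpure _ _ (by omega), hd_hpure _ _ (by omega), hd_hpure _ _ (by omega),
      hs_hpure _ _ (by omega)]
    exact hpure_congr (faceM_degen_lt k i p hi hp m a) fun l _ => faceA_degen_lt i p hi a l
  d_s_gt k i p x hi hi' := by
    refine LinearMap.congr_fun (f := hd R A M (k + 1) (i + 1) ∘ₗ hs R A M (k + 1) p)
      (g := hs R A M k p ∘ₗ hd R A M k i) (hchain_ext fun m a => ?_) x
    simp only [LinearMap.comp_apply]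
    rw [hs_hpure _ _ (by omega), hd_hpure _ _ (by omega), hd_hpure _ _ (by omega),
      hs_hpure _ _ (by omega)]
    exact hpure_congr (faceM_degen_gt k i p hi hi' m a) fun l _ => faceA_degen_gt i p hi a l

theorem hboundary_eq (k : ℕ) : hboundary R A M k = (hochschild R A M).b k := by
  unfold hboundary FaceDegeneracy.b
  rw [Finset.sum_range_succ, Finset.sum_range]
  congr 1
  · refine Finset.sum_congr rfl fun j _ => ?_
    change _ = _ • hd R A M k j
    rw [hd, dif_pos j.2]
  · change _ = _ • hd R A M k (k + 1)
    rw [hd, dif_neg (by omega)]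

end Hochschild

/-! ## Chains on a simplex with coefficients in a simplicial module -/

section Position

variable {V : Type*} [LinearOrder V]

/-- The number of elements of `U` which precede `v`. -/
def pos (U : Finset V) (v : V) : ℕ := (U.filter (· < v)).card

theorem pos_le_card (U : Finset V) (v : V) : pos U v ≤ U.card := Finset.card_filter_le _ _

theorem pos_insert_of_lt {U : Finset V} {v w : V} (hv : v ∉ U) (h : v < w) :
    pos (insert v U) w = pos U w + 1 := by
  unfold pos
  rw [Finset.filter_insert, if_pos h, Finset.card_insert_of_notMem]
  exact fun h => hv (Finset.mem_filter.1 h).1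

theorem pos_insert_of_not_lt {U : Finset V} {v w : V} (h : ¬ v < w) :
    pos (insert v U) w = pos U w := by
  unfold pos
  rw [Finset.filter_insert, if_neg h]

theorem pos_mono (U : Finset V) {v w : V} (h : v ≤ w) : pos U v ≤ pos U w :=
  Finset.card_le_card fun _ hu =>
    Finset.mem_filter.2 ⟨(Finset.mem_filter.1 hu).1, (Finset.mem_filter.1 hu).2.trans_le h⟩

theorem pos_lt_pos {U : Finset V} {u v w : V} (hu : u ∈ U) (hvu : v ≤ u) (huw : u < w) :
    pos U v < pos U w := by
  refine Finset.card_lt_card ⟨fun x hx => ?_, fun h => ?_⟩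
  · rw [Finset.mem_filter] at hx ⊢
    exact ⟨hx.1, hx.2.trans_le (hvu.trans huw.le)⟩
  · exact absurd (Finset.mem_filter.1 (h (Finset.mem_filter.2 ⟨hu, huw⟩))).2 (not_lt.2 hvu)

theorem pos_lt_card {U : Finset V} {v : V} (hv : v ∈ U) : pos U v < U.card :=
  Finset.card_lt_card ⟨Finset.filter_subset _ _, fun h =>
    lt_irrefl v (Finset.mem_filter.1 (h hv)).2⟩

theorem pos_injOn (U : Finset V) : Set.InjOn (pos U) U := by
  intro v hv w hw h
  rcases lt_trichotomy v w with h' | h' | h'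
  · exact absurd h (pos_lt_pos hv le_rfl h').ne
  · exact h'
  · exact absurd h (pos_lt_pos hw le_rfl h').ne'

theorem image_pos (U : Finset V) : U.image (pos U) = Finset.range U.card := by
  refine Finset.eq_of_subset_of_card_le (fun j hj => ?_) ?_
  · obtain ⟨v, hv, rfl⟩ := Finset.mem_image.1 hj
    exact Finset.mem_range.2 (pos_lt_card hv)
  · rw [Finset.card_image_of_injOn (pos_injOn U), Finset.card_range]

theorem sum_pos {N : Type*} [AddCommMonoid N] (U : Finset V) (f : ℕ → N) :
    ∑ v ∈ U, f (pos U v) = ∑ j ∈ Finset.range U.card, f j := by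
  rw [← image_pos, Finset.sum_image (pos_injOn U)]

end Position

/-! ### Initial faces of the simplex -/

section Initial

variable {n : ℕ}

/-- `S` contains the first `p` vertices. -/
def Initial (p : ℕ) (S : Finset (Fin (n + 1))) : Prop := ∀ v : Fin (n + 1), v.1 < p → v ∈ S

/-- The set of the first `p` vertices. -/
def initialSet (n p : ℕ) : Finset (Fin (n + 1)) := Finset.univ.filter fun v => v.1 < p

theorem mem_initialSet {p : ℕ} {v : Fin (n + 1)} : v ∈ initialSet n p ↔ v.1 < p := by
  simp [initialSet]

theorem card_initialSet {p : ℕ} (hp : p ≤ n + 1) : (initialSet n p).card = p := by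
  rw [initialSet, Fin.card_filter_val_lt]
  omega

theorem Initial.eq_initialSet {p : ℕ} {S : Finset (Fin (n + 1))} (h : Initial p S)
    (hp : p ≤ n + 1) (hS : S.card = p) : S = initialSet n p :=
  (Finset.eq_of_subset_of_card_le (fun v hv => h v (mem_initialSet.1 hv))
    (by rw [hS, card_initialSet hp])).symm

theorem pos_eq_val {U : Finset (Fin (n + 1))} {v : Fin (n + 1)} (h : Initial v.1 U) :
    pos U v = v.1 := by
  unfold pos
  rw [← Fin.card_Iio v]
  congr 1
  ext u
  simp only [Finset.mem_filter, Finset.mem_Iio]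
  exact ⟨fun hu => hu.2, fun hu => ⟨h u hu, hu⟩⟩

end Initial

/-! ### Boundary, total and homotopies for chains on the simplex -/

namespace FaceDegeneracy

variable {R : Type*} [CommRing R] {X : ℕ → Type*} [∀ k, AddCommGroup (X k)]
  [∀ k, Module R (X k)] (D : FaceDegeneracy R X) {n : ℕ}

/-- The boundary of a chain on the simplex with vertices `Fin (n + 1)`; only the values of
`y` on sets with `k + 2` elements and those of the result on sets with `k + 1` elements matter. -/
def bdry (k : ℕ) (y : Finset (Fin (n + 1)) → X (k + 1)) (U : Finset (Fin (n + 1))) : X k :=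
  ∑ v ∈ Uᶜ, (-1 : R) ^ pos U v • D.d k (pos U v) (y (insert v U))

theorem bdry_sub (k : ℕ) (y y' : Finset (Fin (n + 1)) → X (k + 1)) (U : Finset (Fin (n + 1))) :
    D.bdry k (fun S => y S - y' S) U = D.bdry k y U - D.bdry k y' U := by
  simp only [bdry, map_sub, smul_sub, Finset.sum_sub_distrib]

theorem bdry_add (k : ℕ) (y y' : Finset (Fin (n + 1)) → X (k + 1)) (U : Finset (Fin (n + 1))) :
    D.bdry k (fun S => y S + y' S) U = D.bdry k y U + D.bdry k y' U := by
  simp only [bdry, map_add, smul_add, Finset.sum_add_distrib]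

theorem bdry_congr {k : ℕ}
    {y y' : Finset (Fin (n + 1)) → X (k + 1)} (h : ∀ S, S.card = k + 2 → y S = y' S)
    {U : Finset (Fin (n + 1))} (hU : U.card = k + 1) : D.bdry k y U = D.bdry k y' U :=
  Finset.sum_congr rfl fun v hv => by
    rw [h _ (by rw [Finset.card_insert_of_notMem (Finset.mem_compl.1 hv), hU])]

/-- `bdry` is defined by collecting contributions at the target `U`. The cochain differential is
given on the summands of its source, and this transposed form is the one comparable with it. -/
theorem bdry_pi_single (k : ℕ)
    (S : Finset (Fin (n + 1))) (z : X (k + 1)) :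
    D.bdry k (Pi.single S z) =
      ∑ v ∈ S, (Pi.single (S.erase v) ((-1 : R) ^ pos S v • D.d k (pos S v) z) :
        Finset (Fin (n + 1)) → X k) := by
  funext U
  unfold bdry
  rw [Finset.sum_apply]
  refine Finset.sum_bij_ne_zero (fun v _ _ => v) ?_ ?_ ?_ ?_
  · intro v hv h
    by_contra hvS
    refine h ?_
    rw [Pi.single_eq_of_ne, map_zero, smul_zero]
    rintro rfl
    exact hvS (Finset.mem_insert_self _ _)
  · exact fun v _ _ w _ _ h => h
  · intro v hv h
    have hU : U = S.erase v := by
      by_contra hU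
      exact h (Pi.single_eq_of_ne hU _)
    subst hU
    refine ⟨v, by simp, ?_, rfl⟩
    rw [Finset.insert_erase hv, Pi.single_eq_same]
    rw [Pi.single_eq_same] at h
    rwa [← pos_insert_of_not_lt (lt_irrefl v), Finset.insert_erase hv]
  · intro v hv h
    have hS : insert v U = S := by
      by_contra hS
      exact h (by rw [Pi.single_eq_of_ne hS, map_zero, smul_zero])
    subst hS
    rw [Finset.mem_compl] at hv
    rw [Finset.erase_insert hv, Pi.single_eq_same, Pi.single_eq_same,
      pos_insert_of_not_lt (lt_irrefl v)]

/-- Inserting the smaller vertex `v` raises the position of `w` by one, while inserting `w` leaves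
that of `v` unchanged. This shift is the one in `d_i d_{j+1} = d_j d_i`, and it makes the signs
opposite. -/
theorem bdry_bdry_term (k : ℕ) (y : Finset (Fin (n + 1)) → X (k + 2))
    {U : Finset (Fin (n + 1))} (hU : U.card ≤ k + 1) {v w : Fin (n + 1)} (hv : v ∉ U)
    (h : v < w) :
    (-1 : R) ^ pos U v • D.d k (pos U v) ((-1 : R) ^ pos (insert v U) w •
      D.d (k + 1) (pos (insert v U) w) (y (insert w (insert v U)))) +
    (-1 : R) ^ pos U w • D.d k (pos U w) ((-1 : R) ^ pos (insert w U) v •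
      D.d (k + 1) (pos (insert w U) v) (y (insert v (insert w U)))) = 0 := by
  rw [pos_insert_of_lt hv h, pos_insert_of_not_lt (not_lt.2 h.le), map_smul, map_smul,
    D.d_d k _ _ _ (pos_mono U h.le) ((pos_le_card U w).trans hU), Finset.insert_comm w v,
    smul_smul, smul_smul, ← Module.add_smul]
  have : (-1 : R) ^ pos U v * (-1) ^ (pos U w + 1) + (-1) ^ pos U w * (-1) ^ pos U v = 0 := by
    ring
  rw [this, zero_smul]

theorem bdry_bdry (k : ℕ) (y : Finset (Fin (n + 1)) → X (k + 2)) {U : Finset (Fin (n + 1))}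
    (hU : U.card ≤ k + 1) : D.bdry k (D.bdry (k + 1) y) U = 0 := by
  simp only [bdry, map_sum, Finset.smul_sum]
  rw [Finset.sum_sigma']
  refine Finset.sum_involution (fun q _ => ⟨q.2, q.1⟩) ?_ ?_ ?_ ?_
  · rintro ⟨v, w⟩ h
    simp only [Finset.mem_sigma, Finset.mem_compl, Finset.mem_insert, not_or] at h
    rcases lt_or_gt_of_ne h.2.1 with h' | h'
    · rw [add_comm]
      exact D.bdry_bdry_term k y hU h.2.2 h'
    · exact D.bdry_bdry_term k y hU h.1 h'
  · rintro ⟨v, w⟩ h _ h'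
    simp only [Finset.mem_sigma, Finset.mem_compl, Finset.mem_insert, not_or] at h
    simp only [Sigma.mk.injEq] at h'
    exact h.2.1 h'.1
  · rintro ⟨v, w⟩ h
    simp only [Finset.mem_sigma, Finset.mem_compl, Finset.mem_insert, not_or] at h ⊢
    exact ⟨h.2.2, fun e => h.2.1 e.symm, h.1⟩
  · rintro ⟨v, w⟩ _
    rfl

/-- The sum of the values of a chain on the simplex. -/
def total (k : ℕ) (y : Finset (Fin (n + 1)) → X k) : X k :=
  ∑ S ∈ Finset.univ.powersetCard (k + 1), y S

theorem total_sub (k : ℕ) (y y' : Finset (Fin (n + 1)) → X k) :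
    total k (fun S => y S - y' S) = total k y - total k y' := Finset.sum_sub_distrib _ _

theorem total_congr {k : ℕ} {y y' : Finset (Fin (n + 1)) → X k}
    (h : ∀ S, S.card = k + 1 → y S = y' S) : total k y = total k y' :=
  Finset.sum_congr rfl fun S hS => h S (Finset.mem_powersetCard.1 hS).2

/-- The vertices of a face `S` with `k + 2` elements occupy each position `0, …, k + 1` once, so `b
(y S)` is a sum over `v ∈ S`. Regrouping the pairs `(S, v)` by `S.erase v` gives the boundary. -/
theorem b_total (k : ℕ) (y : Finset (Fin (n + 1)) → X (k + 1)) :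
    D.b k (total (k + 1) y) = total k (D.bdry k y) := by
  unfold total bdry
  have e : ∀ S ∈ Finset.univ.powersetCard (k + 1 + 1), D.b k (y S) =
      ∑ v ∈ S, (-1 : R) ^ pos S v • D.d k (pos S v) (y S) := fun S hS => by
    rw [sum_pos S fun j => (-1 : R) ^ j • D.d k j (y S), (Finset.mem_powersetCard.1 hS).2,
      b_apply]
  rw [map_sum, Finset.sum_congr rfl e, Finset.sum_sigma', Finset.sum_sigma']
  refine Finset.sum_bij' (fun q _ => ⟨q.1.erase q.2, q.2⟩) (fun q _ => ⟨insert q.2 q.1, q.2⟩)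
    ?_ ?_ ?_ ?_ ?_
  · rintro ⟨S, v⟩ h
    simp only [Finset.mem_sigma, Finset.mem_powersetCard] at h ⊢
    exact ⟨⟨Finset.subset_univ _, by rw [Finset.card_erase_of_mem h.2, h.1.2]; rfl⟩, by simp⟩
  · rintro ⟨U, v⟩ h
    simp only [Finset.mem_sigma, Finset.mem_powersetCard, Finset.mem_compl] at h ⊢
    exact ⟨⟨Finset.subset_univ _, by rw [Finset.card_insert_of_notMem h.2, h.1.2]⟩, by simp⟩
  · rintro ⟨S, v⟩ h
    simp only [Finset.mem_sigma] at h
    simp [Finset.insert_erase h.2]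
  · rintro ⟨U, v⟩ h
    simp only [Finset.mem_sigma, Finset.mem_compl] at h
    simp [Finset.erase_insert h.2]
  · rintro ⟨S, v⟩ h
    simp only [Finset.mem_sigma] at h
    have : pos (S.erase v) v = pos S v := by
      rw [← pos_insert_of_not_lt (lt_irrefl v), Finset.insert_erase h.2]
    simp only [this, Finset.insert_erase h.2]

/-- The homotopy which adds the vertex `p` to a simplex not containing it. -/
def cone (k : ℕ) (p : Fin (n + 1)) (y : Finset (Fin (n + 1)) → X k)
    (W : Finset (Fin (n + 1))) : X (k + 1) :=
  if p ∈ W then (-1 : R) ^ p.1 • D.s k p.1 (y (W.erase p)) else 0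

/-! ### Reduction of cycles to the initial face -/

section Reduction

variable {k : ℕ} {p : Fin (n + 1)} {y : Finset (Fin (n + 1)) → X k}

theorem vanish_zero (k p : ℕ) : D.Vanish k p 0 := by
  obtain _ | k := k
  · trivial
  · exact fun i _ _ => map_zero _

/-- Only the added vertex `v = p` contributes. Where `U` contains all vertices below `p`, its
position is `p`, and `d_p s_p = 1` returns `y U`; elsewhere `y U` is zero already. -/
theorem bdry_cone_of_notMem (hp : p.1 ≤ k)
    (hs : ∀ S, S.card = k + 1 → ¬ Initial p.1 S → y S = 0) {U : Finset (Fin (n + 1))}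
    (hU : U.card = k + 1) (hpU : p ∉ U) : D.bdry k (D.cone k p y) U = y U := by
  unfold bdry
  rw [Finset.sum_eq_single p]
  · rw [cone, if_pos (Finset.mem_insert_self _ _), Finset.erase_insert hpU]
    by_cases h : Initial p.1 U
    · rw [pos_eq_val h, map_smul, smul_smul, ← mul_pow, D.d_s_self _ _ _ hp]
      simp
    · rw [hs U hU h]
      simp
  · intro v _ hvp
    rw [cone, if_neg, map_zero, smul_zero]
    simp [hpU, hvp.symm]
  · intro h
    exact absurd (Finset.mem_compl.2 hpU) h

/-- A term survives the support condition only if `v` is the one missing vertex below `p`. Its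
position is then its own value, and `d_v s_p` is zero on elements whose faces below `p` vanish. -/
theorem bdry_cone_of_not_initial (hp : p.1 ≤ k)
    (hs : ∀ S, S.card = k + 1 → ¬ Initial p.1 S → y S = 0)
    (hv : ∀ S, S.card = k + 1 → D.Vanish k p.1 (y S)) {U : Finset (Fin (n + 1))}
    (hU : U.card = k + 1) (hpU : p ∈ U) (hi : ¬ Initial p.1 U) :
    D.bdry k (D.cone k p y) U = 0 := by
  refine Finset.sum_eq_zero fun v hvU => ?_
  rw [Finset.mem_compl] at hvU
  have hmem : p ∈ insert v U := Finset.mem_insert_of_mem hpU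
  have hcard : ((insert v U).erase p).card = k + 1 := by
    rw [Finset.card_erase_of_mem hmem, Finset.card_insert_of_notMem hvU, hU]; rfl
  rw [cone, if_pos hmem]
  by_cases h : Initial p.1 ((insert v U).erase p)
  · have h1 : ∀ u : Fin (n + 1), u.1 < p.1 → u = v ∨ u ∈ U := fun u hu =>
      Finset.mem_insert.1 (Finset.mem_of_mem_erase (h u hu))
    have hvp : v.1 < p.1 := by
      by_contra hvp
      refine hi fun u hu => (h1 u hu).resolve_left ?_
      rintro rfl
      exact hvp hu
    have : Initial v.1 U := fun u hu => (h1 u (hu.trans hvp)).resolve_left (by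
      rintro rfl; exact lt_irrefl _ hu)
    rw [pos_eq_val this, map_smul, D.d_s_eq_zero _ (hv _ hcard) hp hvp, smul_zero, smul_zero]
  · rw [hs _ hcard h]
    simp

/-- Here all vertices outside `U` exceed `p`. Applying `d_p` to the homotopy terms removes `s_p` and
leaves the terms other than `d_p (y U)` in the cycle equation of `y` at `U.erase p`; that equation
makes everything cancel. -/
theorem vanish_cone_step {y : Finset (Fin (n + 1)) → X (k + 1)} (hp : p.1 ≤ k + 1)
    (hv : ∀ S, S.card = k + 2 → D.Vanish (k + 1) p.1 (y S))
    (hc : ∀ U : Finset (Fin (n + 1)), U.card = k + 1 → D.bdry k y U = 0)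
    {U : Finset (Fin (n + 1))} (hU : U.card = k + 2) (hpU : p ∈ U) (hi : Initial p.1 U) :
    D.Vanish (k + 1) (p.1 + 1) (y U - D.bdry (k + 1) (D.cone (k + 1) p y) U) := by
  have hlt : ∀ v ∈ Uᶜ, p < v := fun v hvU => by
    rw [Finset.mem_compl] at hvU
    rcases lt_trichotomy v p with h | h | h
    · exact absurd (hi v h) hvU
    · exact absurd (h ▸ hpU) hvU
    · exact h
  have hpos : ∀ v ∈ Uᶜ, pos U v = pos (U.erase p) v + 1 := fun v hvU => by
    rw [← pos_insert_of_lt (Finset.notMem_erase p U) (hlt v hvU), Finset.insert_erase hpU]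
  have hinit : Initial p.1 (U.erase p) := fun u hu =>
    Finset.mem_erase.2 ⟨fun h => by rw [h] at hu; exact lt_irrefl _ hu, hi u hu⟩
  have hple : ∀ v ∈ Uᶜ, p.1 ≤ pos (U.erase p) v := fun v hvU =>
    (pos_eq_val hinit).symm.le.trans (pos_mono _ (hlt v hvU).le)
  have hcardE : (U.erase p).card = k + 1 := by
    rw [Finset.card_erase_of_mem hpU, hU]; rfl
  have hposle : ∀ v, pos (U.erase p) v ≤ k + 1 := fun v =>
    (pos_le_card _ v).trans hcardE.le
  have hcard : ∀ v ∈ Uᶜ, (insert v (U.erase p)).card = k + 2 := fun v hvU => by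
    rw [Finset.card_insert_of_notMem, hcardE]
    exact fun h => Finset.mem_compl.1 hvU (Finset.mem_of_mem_erase h)
  have herase : ∀ v ∈ Uᶜ, (insert v U).erase p = insert v (U.erase p) := fun v hvU =>
    Finset.erase_insert_of_ne (hlt v hvU).ne'
  have hcone : D.bdry (k + 1) (D.cone (k + 1) p y) U = ∑ v ∈ Uᶜ,
      (-1 : R) ^ (pos (U.erase p) v + 1) • D.d (k + 1) (pos (U.erase p) v + 1)
        ((-1 : R) ^ p.1 • D.s (k + 1) p.1 (y (insert v (U.erase p)))) :=
    Finset.sum_congr rfl fun v hvU => by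
      rw [hpos v hvU, cone, if_pos (Finset.mem_insert_of_mem hpU), herase v hvU]
  intro i hi' hik
  rw [map_sub, hcone, map_sum]
  obtain hip | hip := (Nat.lt_succ_iff.1 hi').lt_or_eq
  · rw [hv U hU i hip hik, Finset.sum_eq_zero, sub_zero]
    intro v hvU
    rw [map_smul, map_smul, map_smul,
      D.d_d k i _ _ (hip.le.trans (hple v hvU)) (hposle v),
      D.d_s_eq_zero _ (hv _ (hcard v hvU)) hp hip]
    simp
  · subst hip
    have e := hc _ hcardE
    have hcompl : (U.erase p)ᶜ = insert p Uᶜ := by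
      ext u
      simp only [Finset.mem_compl, Finset.mem_erase, Finset.mem_insert]
      tauto
    unfold bdry at e
    rw [hcompl, Finset.sum_insert (by simpa using hpU), Finset.insert_erase hpU,
      pos_eq_val hinit] at e
    have e' : ∑ v ∈ Uᶜ, D.d k p.1 ((-1 : R) ^ (pos (U.erase p) v + 1) •
        D.d (k + 1) (pos (U.erase p) v + 1)
          ((-1 : R) ^ p.1 • D.s (k + 1) p.1 (y (insert v (U.erase p))))) =
        -((-1 : R) ^ p.1 • ∑ v ∈ Uᶜ, (-1 : R) ^ pos (U.erase p) v •
          D.d k (pos (U.erase p) v) (y (insert v (U.erase p)))) := by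
      rw [Finset.smul_sum, ← Finset.sum_neg_distrib]
      refine Finset.sum_congr rfl fun v hvU => ?_
      rw [map_smul, map_smul, map_smul, D.d_d k _ _ _ (hple v hvU) (hposle v),
        D.d_s_self _ _ _ hp, pow_succ, mul_neg_one, neg_smul, smul_comm]
    rw [e', eq_neg_of_add_eq_zero_right e, smul_neg, neg_neg, smul_smul, ← mul_pow]
    simp

/-- `y` is a cycle. -/
def IsCycle : ∀ k : ℕ, (Finset (Fin (n + 1)) → X k) → Prop
  | 0, _ => True
  | k + 1, y => ∀ U : Finset (Fin (n + 1)), U.card = k + 1 → D.bdry k y U = 0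

theorem isCycle_sub_bdry (h : D.IsCycle k y) (u : Finset (Fin (n + 1)) → X (k + 1)) :
    D.IsCycle k fun S => y S - D.bdry k u S := by
  obtain _ | k := k
  · trivial
  intro U hU
  rw [bdry_sub, h U hU, D.bdry_bdry k u hU.le, sub_zero]

theorem exists_reduce_step (hp : p.1 ≤ k) (hc : D.IsCycle k y)
    (hs : ∀ S, S.card = k + 1 → ¬ Initial p.1 S → y S = 0)
    (hv : ∀ S, S.card = k + 1 → D.Vanish k p.1 (y S)) :
    (∀ S, S.card = k + 1 → ¬ Initial (p.1 + 1) S → y S - D.bdry k (D.cone k p y) S = 0) ∧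
    (∀ S, S.card = k + 1 → D.Vanish k (p.1 + 1) (y S - D.bdry k (D.cone k p y) S)) := by
  have H : ∀ S, S.card = k + 1 → ¬ (p ∈ S ∧ Initial p.1 S) →
      y S - D.bdry k (D.cone k p y) S = 0 := fun S hS h => by
    by_cases hpS : p ∈ S
    · have hi : ¬ Initial p.1 S := fun hi => h ⟨hpS, hi⟩
      rw [D.bdry_cone_of_not_initial hp hs hv hS hpS hi, hs S hS hi, sub_zero]
    · rw [D.bdry_cone_of_notMem hp hs hS hpS, sub_self]
  refine ⟨fun S hS h => H S hS fun h' => h fun v hv => ?_, fun S hS => ?_⟩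
  · obtain h1 | h1 := (Nat.lt_succ_iff.1 hv).lt_or_eq
    · exact h'.2 v h1
    · exact Fin.ext h1 ▸ h'.1
  · by_cases h : p ∈ S ∧ Initial p.1 S
    · obtain _ | k := k
      · trivial
      exact D.vanish_cone_step hp hv hc hS h.1 h.2
    · rw [H S hS h]
      exact D.vanish_zero _ _

/-- Every cycle on the simplex is homologous to one in the Moore complex, put on the initial
face. -/
theorem exists_reduce (hk : k ≤ n) (hc : D.IsCycle k y) :
    ∃ u : Finset (Fin (n + 1)) → X (k + 1),
      (∀ S, S.card = k + 1 → S ≠ initialSet n (k + 1) → y S - D.bdry k u S = 0) ∧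
      D.Vanish k k (y (initialSet n (k + 1)) - D.bdry k u (initialSet n (k + 1))) := by
  -- At stage `p` the chain is supported on faces containing the first `p` vertices. For `p = k + 1`
  -- the only such face with `k + 1` vertices is the initial one.
  suffices H : ∀ p ≤ k + 1, ∃ u : Finset (Fin (n + 1)) → X (k + 1),
      (∀ S, S.card = k + 1 → ¬ Initial p S → y S - D.bdry k u S = 0) ∧
      (∀ S, S.card = k + 1 → D.Vanish k p (y S - D.bdry k u S)) by
    obtain ⟨u, h1, h2⟩ := H (k + 1) le_rfl
    refine ⟨u, fun S hS h => h1 S hS fun h' => h (h'.eq_initialSet (by omega) hS), ?_⟩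
    have := h2 _ (card_initialSet (n := n) (p := k + 1) (by omega))
    obtain _ | k := k
    · trivial
    · exact fun i hi => this i (by omega)
  intro p
  induction p with
  | zero =>
    refine fun _ => ⟨fun _ => 0, fun S _ h => absurd (fun v hv => absurd hv (Nat.not_lt_zero _)) h,
      fun S _ => ?_⟩
    obtain _ | k := k
    · trivial
    · exact fun i hi => absurd hi (Nat.not_lt_zero _)
  | succ p ih =>
    intro hp
    obtain ⟨u, h1, h2⟩ := ih (by omega)
    obtain ⟨h3, h4⟩ := D.exists_reduce_step (p := ⟨p, by omega⟩) (by simp only; omega)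
      (D.isCycle_sub_bdry hc u) h1 h2
    refine ⟨fun S => u S + D.cone k ⟨p, by omega⟩ (fun S => y S - D.bdry k u S) S, ?_⟩
    have e : ∀ S, y S - D.bdry k (fun S => u S + D.cone k ⟨p, by omega⟩
        (fun S => y S - D.bdry k u S) S) S = y S - D.bdry k u S -
        D.bdry k (D.cone k ⟨p, by omega⟩ (fun S => y S - D.bdry k u S)) S := fun S => by
      rw [bdry_add, sub_sub]
    simp only [e]
    exact ⟨h3, h4⟩

end Reduction

/-- Removing the vertex `v` from the initial face applies `d_v`, and on `w` all of these vanish but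
the last. Removing the last vertex leaves the smaller initial face, and the surviving term is all of
`b w`. -/
theorem bdry_single {k : ℕ} (hk : k + 1 ≤ n) (w : X (k + 1)) (hw : D.Vanish (k + 1) (k + 1) w)
    {U : Finset (Fin (n + 1))} (hU : U.card = k + 1) :
    D.bdry k (Pi.single (initialSet n (k + 2)) w) U =
      (Pi.single (initialSet n (k + 1)) (D.b k w) : Finset (Fin (n + 1)) → X k) U := by
  have hterm : ∀ v : Fin (n + 1), v.1 = k + 1 →
      insert v (initialSet n (k + 1)) = initialSet n (k + 2) := fun v hv => by
    ext u
    simp only [Finset.mem_insert, mem_initialSet, Fin.ext_iff]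
    omega
  have hz : ∀ v ∈ Uᶜ, ¬ (v.1 = k + 1 ∧ U = initialSet n (k + 1)) →
      (-1 : R) ^ pos U v • D.d k (pos U v)
        ((Pi.single (initialSet n (k + 2)) w : Finset (Fin (n + 1)) → X (k + 1))
          (insert v U)) = 0 := fun v hvU h => by
    rw [Finset.mem_compl] at hvU
    by_cases hS : insert v U = initialSet n (k + 2)
    · have hvk : v.1 < k + 2 := mem_initialSet.1 (hS ▸ Finset.mem_insert_self v U)
      have hmem : ∀ u : Fin (n + 1), u.1 < k + 2 → u = v ∨ u ∈ U := fun u hu =>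
        Finset.mem_insert.1 (hS ▸ mem_initialSet.2 hu)
      have hinit : Initial v.1 U := fun u hu => (hmem u (by omega)).resolve_left
        (by rintro rfl; exact lt_irrefl _ hu)
      have hne : v.1 ≠ k + 1 := fun hv => h ⟨hv, Initial.eq_initialSet (hv ▸ hinit) (by omega) hU⟩
      rw [hS, Pi.single_eq_same, pos_eq_val hinit, hw v.1 (by omega) (by omega), smul_zero]
    · rw [Pi.single_eq_of_ne hS, map_zero, smul_zero]
  by_cases hU' : U = initialSet n (k + 1)
  · subst hU'
    obtain ⟨q, hq⟩ : ∃ q : Fin (n + 1), q.1 = k + 1 := ⟨⟨k + 1, by omega⟩, rfl⟩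
    have hmem : q ∉ initialSet n (k + 1) := by
      simp [mem_initialSet, hq]
    unfold bdry
    rw [Finset.sum_eq_single q, Pi.single_eq_same, hterm _ hq, Pi.single_eq_same, b_apply,
      Finset.sum_range_succ, Finset.sum_eq_zero, zero_add,
      pos_eq_val fun v hv => mem_initialSet.2 (hq ▸ hv), hq]
    · intro i hi
      rw [Finset.mem_range] at hi
      rw [hw i hi (by omega), smul_zero]
    · exact fun v hv h => hz v hv fun h' => h (Fin.ext (h'.1.trans hq.symm))
    · exact fun h => absurd (Finset.mem_compl.2 hmem) h
  · rw [Pi.single_eq_of_ne hU']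
    exact Finset.sum_eq_zero fun v hv => hz v hv fun h => hU' h.2

theorem total_single {k : ℕ} (hk : k ≤ n) (z : X k) :
    total k (Pi.single (initialSet n (k + 1)) z) = z := by
  unfold total
  rw [Finset.sum_eq_single (initialSet n (k + 1))]
  · exact Pi.single_eq_same _ _
  · exact fun S _ h => Pi.single_eq_of_ne h _
  · exact fun h => absurd (Finset.mem_powersetCard.2 ⟨Finset.subset_univ _,
      card_initialSet (by omega)⟩) h

/-- `x` is a cycle of the complex `X`. -/
def IsBCycle : ∀ k : ℕ, X k → Prop
  | 0, _ => True
  | k + 1, x => D.b k x = 0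

theorem isBCycle_total {k : ℕ} {y : Finset (Fin (n + 1)) → X k} (hc : D.IsCycle k y) :
    D.IsBCycle k (total k y) := by
  obtain _ | k := k
  · trivial
  · change D.b k _ = 0
    rw [b_total]
    exact Finset.sum_eq_zero fun U hU => hc U (Finset.mem_powersetCard.1 hU).2

/-- `total` is surjective on homology. -/
theorem exists_total_eq {k : ℕ} (hk : k ≤ n) (x : X k) (hx : D.IsBCycle k x) :
    ∃ y : Finset (Fin (n + 1)) → X k, D.IsCycle k y ∧ x - total k y ∈ LinearMap.range (D.b k) := by
  obtain _ | k := k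
  · exact ⟨Pi.single (initialSet n 1) x, trivial, by rw [total_single hk]; simp⟩
  · have hx' : D.b k x = 0 := hx
    obtain ⟨z, h1, h2, h3⟩ := D.exists_vanish x (hx' ▸ D.vanish_zero k k)
    refine ⟨Pi.single (initialSet n (k + 2)) z, fun U hU => ?_, ?_⟩
    · rw [D.bdry_single hk z h1 hU, h2, hx']
      simp
    · rw [total_single hk]
      exact h3 hx'

/-- `total` is injective on homology below the dimension of the simplex. -/
theorem exists_eq_bdry {k : ℕ} (hk : k < n) (y : Finset (Fin (n + 1)) → X k)
    (hc : D.IsCycle k y) (hy : total k y ∈ LinearMap.range (D.b k)) :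
    ∃ u : Finset (Fin (n + 1)) → X (k + 1), ∀ S, S.card = k + 1 → y S = D.bdry k u S := by
  obtain ⟨u, h1, h2⟩ := D.exists_reduce hk.le hc
  have e : ∀ S, S.card = k + 1 → y S - D.bdry k u S =
      (Pi.single (initialSet n (k + 1)) (y (initialSet n (k + 1)) -
        D.bdry k u (initialSet n (k + 1))) : Finset (Fin (n + 1)) → X k) S := fun S hS => by
    by_cases h : S = initialSet n (k + 1)
    · subst h
      rw [Pi.single_eq_same]
    · rw [h1 S hS h, Pi.single_eq_of_ne h]
  obtain ⟨w, hw⟩ := hy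
  -- The total of the reduced cycle is its single value on the initial face. So this value is a
  -- boundary in `X`, with a primitive that need not be in the Moore complex yet.
  have e1 : D.b k (w - total (k + 1) u) =
      y (initialSet n (k + 1)) - D.bdry k u (initialSet n (k + 1)) := by
    rw [map_sub, hw, b_total, ← total_sub, total_congr e, total_single hk.le]
  -- The value is a Moore element, so the primitive can be made Moore without changing its boundary.
  -- Placed on the initial face with `k + 2` vertices, it then bounds the reduced cycle.
  obtain ⟨w', h3, h4, -⟩ := D.exists_vanish (w - total (k + 1) u) (e1 ▸ h2)
  refine ⟨fun S => u S + (Pi.single (initialSet n (k + 2)) w' :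
    Finset (Fin (n + 1)) → X (k + 1)) S, fun S hS => ?_⟩
  have e2 := e S hS
  rw [← e1, ← h4, ← D.bdry_single hk w' h3 hS] at e2
  rw [bdry_add, ← e2, add_sub_cancel]

end FaceDegeneracy

/-! ## Coefficients as Hochschild chains -/

section Index

variable {V : Type*} [Fintype V] [LinearOrder V]

theorem index_rep (H : Finset (V × V)) (v : V) : index H (rep H v) = index H v := by
  unfold index
  rw [rep_rep]

theorem rep_lt_of_index_lt {H : Finset (V × V)} {v w : V} (h : index H v < index H w) :
    rep H v < rep H w := by
  by_contra h'
  refine absurd (Finset.card_le_card fun r hr => ?_) (not_le.2 h)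
  rw [Finset.mem_filter] at hr ⊢
  exact ⟨hr.1, hr.2.1, hr.2.2.trans_le (not_lt.1 h')⟩

theorem index_lt_of_rep_lt {H : Finset (V × V)} {v w : V} (h : rep H v < rep H w) :
    index H v < index H w := by
  refine Finset.card_lt_card ⟨fun r hr => ?_, fun hs => ?_⟩
  · rw [Finset.mem_filter] at hr ⊢
    exact ⟨hr.1, hr.2.1, hr.2.2.trans h⟩
  · exact lt_irrefl _ (Finset.mem_filter.1 (hs (Finset.mem_filter.2
      ⟨Finset.mem_univ _, rep_rep H v, h⟩))).2.2

variable [OrderBot V]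

theorem rep_bot (H : Finset (V × V)) : rep H ⊥ = ⊥ := bot_unique (rep_le (Conn.refl H ⊥))

open Classical in
/-- The components of `H` other than that of the base vertex, in their order. -/
def idxIso (H : Finset (V × V)) {k : ℕ} (h : Fintype.card (Idx H) = k) : Fin k ≃o Idx H :=
  Fintype.orderIsoFinOfCardEq (Idx H) h

/-- The shift by one accounts for the base component, which has index `0` and carries `M` instead of
a factor `A`. -/
theorem index_idxIso (H : Finset (V × V)) {k : ℕ} (h : Fintype.card (Idx H) = k) (j : Fin k) :
    index H (idxIso H h j).1 = j.1 + 1 := by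
  classical
  have e : (Finset.univ.filter fun r => rep H r = r ∧ r < rep H (idxIso H h j).1) =
      insert ⊥ ((Finset.Iio j).image fun i => (idxIso H h i).1) := by
    rw [(idxIso H h j).2.1]
    ext r
    simp only [Finset.mem_filter, Finset.mem_univ, true_and, Finset.mem_insert, Finset.mem_image,
      Finset.mem_Iio]
    constructor
    · rintro ⟨hr, hlt⟩
      by_cases hb : r = ⊥
      · exact Or.inl hb
      · refine Or.inr ⟨(idxIso H h).symm ⟨r, hr, hb⟩, ?_, by simp⟩
        rw [← (idxIso H h).lt_iff_lt, OrderIso.apply_symm_apply]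
        exact hlt
    · rintro (rfl | ⟨i, hi, rfl⟩)
      · exact ⟨rep_bot H, bot_lt_iff_ne_bot.2 (idxIso H h j).2.2⟩
      · exact ⟨(idxIso H h i).2.1, (idxIso H h).lt_iff_lt.2 hi⟩
  unfold index
  rw [e, Finset.card_insert_of_notMem, Finset.card_image_of_injective, Fin.card_Iio]
  · exact fun i i' hi => (idxIso H h).injective (Subtype.ext hi)
  · intro hb
    obtain ⟨i, -, hi⟩ := Finset.mem_image.1 hb
    exact (idxIso H h i).2.2 hi

theorem idxIso_symm_val (H : Finset (V × V)) {k : ℕ} (h : Fintype.card (Idx H) = k)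
    (r : Idx H) : ((idxIso H h).symm r).1 + 1 = index H r.1 := by
  rw [← index_idxIso H h, OrderIso.apply_symm_apply]

theorem rep_eq_bot_of_index {H : Finset (V × V)} {v : V} (h : index H v = 0) : rep H v = ⊥ := by
  by_contra hb
  have := idxIso_symm_val H rfl ⟨rep H v, rep_rep H v, hb⟩
  rw [index_rep, h] at this
  omega

theorem rep_ne_bot_of_index {H : Finset (V × V)} {v : V} (h : index H v ≠ 0) : rep H v ≠ ⊥ := by
  intro hb
  refine h (Finset.card_eq_zero.2 (Finset.filter_eq_empty_iff.2 fun r _ hr => ?_))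
  rw [hb] at hr
  exact not_lt_bot hr.2

end Index

/-! ### Naturality of merging under relabelling of the factors -/

section Reindex

variable (R A M : Type*) [CommRing R] [Ring A] [Algebra R A] [AddCommGroup M] [Module R M]
  [Module A M] [Module Aᵐᵒᵖ M] [SMulCommClass A Aᵐᵒᵖ M] [IsScalarTower R A M]
  [IsScalarTower R Aᵐᵒᵖ M]

/-- Relabelling of the factors `A`. -/
def relabel {ι ι' : Type*} (σ : ι ≃ ι') : TensorMod R A M ι ≃ₗ[R] TensorMod R A M ι' :=
  TensorProduct.congr (LinearEquiv.refl R M) (PiTensorProduct.reindex R (fun _ => A) σ)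

variable {R A M}

theorem relabel_tmul {ι ι' : Type*} (σ : ι ≃ ι') (m : M) (a : ι → A) :
    relabel R A M σ (m ⊗ₜ PiTensorProduct.tprod R a) =
      m ⊗ₜ PiTensorProduct.tprod R fun i => a (σ.symm i) := by
  unfold relabel
  rw [TensorProduct.congr_tmul, LinearEquiv.refl_apply, PiTensorProduct.reindex_tprod]

section

variable {κ κ' : Type*} [DecidableEq κ] [DecidableEq κ'] (τ : κ ≃ κ') (u : Option κ) (a : A)

theorem update_comp_symm (p : κ) (b : A) (x : κ → A) :
    (fun i => Function.update x p b (τ.symm i)) =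
      Function.update (fun i => x (τ.symm i)) (τ p) b := by
  funext i
  by_cases h : i = τ p
  · subst h
    simp
  · have h' : τ.symm i ≠ p := fun h' => h (by rw [← h', Equiv.apply_symm_apply])
    rw [Function.update_of_ne h, Function.update_of_ne h']

theorem relabel_slotMulLeft (x : TensorMod R A M κ) :
    relabel R A M τ (slotMulLeft R A M u a x) =
      slotMulLeft R A M (u.map τ) a (relabel R A M τ x) := by
  refine LinearMap.congr_fun (f := (relabel R A M τ).toLinearMap ∘ₗ slotMulLeft R A M u a)
    (g := slotMulLeft R A M (u.map τ) a ∘ₗ (relabel R A M τ).toLinearMap)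
    (tensorMod_ext fun m b => ?_) x
  cases u with
  | none => simp [slotMulLeft_none, relabel_tmul]
  | some p => simp [slotMulLeft_some, relabel_tmul, update_comp_symm]

theorem relabel_slotMulRight (x : TensorMod R A M κ) :
    relabel R A M τ (slotMulRight R A M u a x) =
      slotMulRight R A M (u.map τ) a (relabel R A M τ x) := by
  refine LinearMap.congr_fun (f := (relabel R A M τ).toLinearMap ∘ₗ slotMulRight R A M u a)
    (g := slotMulRight R A M (u.map τ) a ∘ₗ (relabel R A M τ).toLinearMap)
    (tensorMod_ext fun m b => ?_) x
  cases u with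
  | none => simp [slotMulRight_none, relabel_tmul]
  | some p => simp [slotMulRight_some, relabel_tmul, update_comp_symm]

theorem relabel_absorb {ι ι' : Type*} (σ : ι ≃ ι') {v : ι} {v' : ι'} {g : κ → ι} {g' : κ' → ι'}
    (hg : Function.Injective g) (hv : ∀ i, i ∈ Set.range g ↔ i ≠ v)
    (hg' : Function.Injective g') (hv' : ∀ i, i ∈ Set.range g' ↔ i ≠ v')
    {act : A →ₗ[R] TensorMod R A M κ →ₗ[R] TensorMod R A M κ}
    {act' : A →ₗ[R] TensorMod R A M κ' →ₗ[R] TensorMod R A M κ'}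
    (hact : ∀ a x, relabel R A M τ (act a x) = act' a (relabel R A M τ x))
    (hσ : σ v = v') (hστ : ∀ i, σ (g i) = g' (τ i)) (x : TensorMod R A M ι) :
    relabel R A M τ (absorb R A M v g hg hv act x) =
      absorb R A M v' g' hg' hv' act' (relabel R A M σ x) := by
  refine LinearMap.congr_fun
    (f := (relabel R A M τ).toLinearMap ∘ₗ absorb R A M v g hg hv act)
    (g := absorb R A M v' g' hg' hv' act' ∘ₗ (relabel R A M σ).toLinearMap)
    (tensorMod_ext fun m b => ?_) x
  simp only [LinearMap.comp_apply, LinearEquiv.coe_coe, absorb_tmul, relabel_tmul, hact]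
  have h1 : σ.symm v' = v := by rw [← hσ, Equiv.symm_apply_apply]
  have h2 : (fun i => b (g (τ.symm i))) = fun k => b (σ.symm (g' k)) := funext fun i => by
    rw [← Equiv.apply_symm_apply τ i, ← hστ, Equiv.symm_apply_apply, Equiv.symm_apply_apply]
  rw [h1, h2]

end

end Reindex

/-! ### Edge maps as Hochschild faces -/

section Compare

variable (R A M : Type*) [CommRing R] [Ring A] [Algebra R A] [AddCommGroup M] [Module R M]
  [Module A M] [Module Aᵐᵒᵖ M] [SMulCommClass A Aᵐᵒᵖ M] [IsScalarTower R A M]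
  [IsScalarTower R Aᵐᵒᵖ M]
variable {V : Type*} [Fintype V] [LinearOrder V] [OrderBot V]

/-- The identification of `F(H)` with Hochschild chains given by the order of the components. -/
def coeffEquiv (H : Finset (V × V)) {k : ℕ} (h : Fintype.card (Idx H) = k) :
    Coeff R A M H ≃ₗ[R] HChain R A M k :=
  Coeff.equiv R A M H ≪≫ₗ relabel R A M (idxIso H h).symm.toEquiv

variable {R A M}

/-- Both sides are strictly increasing in `r` and omit exactly the position `j` of the label that
disappears. A strictly increasing map is determined by its range. -/
theorem idxIso_symm_insert {H : Finset (V × V)} {e : V × V} {k : ℕ} (he : ¬ Conn H e.1 e.2)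
    (h : Fintype.card (Idx H) = k + 1) (h' : Fintype.card (Idx (insert e H)) = k)
    {j : Fin (k + 1)} (hj : index H (max (rep H e.1) (rep H e.2)) = j.1 + 1)
    {r : Idx (insert e H)} {r' : Idx H} (hr : r'.1 = r.1) :
    (idxIso H h).symm r' = j.succAbove ((idxIso (insert e H) h').symm r) := by
  let g : Idx (insert e H) → Idx H := fun r => ⟨r.1, ((isRep_insert_iff he).1 r.2.1).1, r.2.2⟩
  have hm : StrictMono fun i => (idxIso H h).symm (g (idxIso (insert e H) h' i)) :=
    fun i i' hi => (idxIso H h).symm.lt_iff_lt.2 ((idxIso (insert e H) h').lt_iff_lt.2 hi :)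
  have hrange := (StrictMono.range_inj hm (Fin.strictMono_succAbove j)).1 (by
    ext i
    rw [range_succAbove_iff]
    have hi := index_idxIso H h i
    constructor
    · rintro ⟨i', rfl⟩ hj'
      refine ((isRep_insert_iff he).1 (idxIso (insert e H) h' i').2.1).2 ?_
      have hmax : rep H (max (rep H e.1) (rep H e.2)) = max (rep H e.1) (rep H e.2) := by
        rcases max_choice (rep H e.1) (rep H e.2) with h1 | h1 <;> rw [h1, rep_rep]
      simp only [OrderIso.apply_symm_apply] at hi
      rw [show (idxIso H h).symm (g (idxIso (insert e H) h' i')) = j from hj', ← hj] at hi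
      have h1 := (g (idxIso (insert e H) h' i')).2.1
      refine h1.symm.trans (Eq.trans ?_ hmax)
      rcases lt_trichotomy (rep H (g (idxIso (insert e H) h' i')).1)
        (rep H (max (rep H e.1) (rep H e.2))) with h2 | h2 | h2
      · exact absurd hi (index_lt_of_rep_lt h2).ne
      · exact h2
      · exact absurd hi (index_lt_of_rep_lt h2).ne'
    · intro hne
      have hi' : (idxIso H h i).1 ≠ max (rep H e.1) (rep H e.2) := fun h1 =>
        hne (Fin.ext (by rw [h1, hj] at hi; omega))
      exact ⟨(idxIso (insert e H) h').symm ⟨(idxIso H h i).1,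
        (isRep_insert_iff he).2 ⟨(idxIso H h i).2.1, hi'⟩, (idxIso H h i).2.2⟩, by simp [g]⟩)
  have hg : g r = r' := Subtype.ext hr.symm
  have := congrFun hrange ((idxIso (insert e H) h').symm r)
  rw [← hg]
  simpa using this

theorem coeffEquiv_edgeMap_right {H : Finset (V × V)} {e : V × V} {k : ℕ}
    (he : ¬ Conn H e.1 e.2) (h : Fintype.card (Idx H) = k + 1)
    (h' : Fintype.card (Idx (insert e H)) = k) (hi : index H e.2 = index H e.1 + 1)
    (x : Coeff R A M H) :
    coeffEquiv R A M (insert e H) h' (edgeMap R A M H e x) =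
      hd R A M k (index H e.1) (coeffEquiv R A M H h x) := by
  have hlt : rep H e.1 < rep H e.2 := rep_lt_of_index_lt (by omega)
  have hmax : max (rep H e.1) (rep H e.2) = rep H e.2 := max_eq_right hlt.le
  have hmin : min (rep H e.1) (rep H e.2) = rep H e.1 := min_eq_left hlt.le
  have hj : index H (max (rep H e.1) (rep H e.2)) = index H e.1 + 1 := by
    rw [hmax, index_rep, hi]
  have hpos : ∀ v : Idx H, v.1 = max (rep H e.1) (rep H e.2) →
      ((idxIso H h).symm v).1 = index H e.1 := fun v hv => by
    have := idxIso_symm_val H h v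
    rw [hv, hj] at this
    omega
  have hle : index H e.1 < k + 1 := by
    rw [← hpos ⟨rep H e.2, rep_rep _ _, (bot_le.trans_lt hlt).ne'⟩ hmax.symm]
    exact Fin.is_lt _
  unfold hd
  rw [dif_pos hle]
  unfold edgeMap
  rw [dif_neg he]
  simp only [LinearMap.comp_apply, LinearEquiv.coe_coe, coeffEquiv, LinearEquiv.trans_apply,
    LinearEquiv.apply_symm_apply, if_pos hlt]
  unfold hface
  refine relabel_absorb _ _ _ _ _ _ (fun a y => ?_) (Fin.ext (hpos _ rfl)) (fun r => ?_) _
  · rw [relabel_slotMulRight]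
    congr 2
    by_cases hu : min (rep H e.1) (rep H e.2) = ⊥
    · have h0 : index H e.1 = 0 := by
        by_contra h0
        exact rep_ne_bot_of_index h0 (hmin ▸ hu)
      rw [dif_pos hu, prevSlot, dif_pos h0, Option.map_none]
    · have h0 : index H e.1 ≠ 0 := fun h0 => hu (by rw [hmin, rep_eq_bot_of_index h0])
      rw [dif_neg hu, prevSlot, dif_neg h0, Option.map_some]
      congr 2
      have h1 := idxIso_symm_insert he h h' (j := ⟨index H e.1, hle⟩) hj
        (r := ⟨min (rep H e.1) (rep H e.2), (isRep_insert_iff he).2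
          ⟨by rw [hmin, rep_rep], (min_lt_max.2 hlt.ne).ne⟩, hu⟩)
        (r' := ⟨rep H e.1, rep_rep _ _, hmin ▸ hu⟩) hmin.symm
      have h2 := idxIso_symm_val H h ⟨rep H e.1, rep_rep _ _, hmin ▸ hu⟩
      rw [h1, index_rep] at h2
      refine Fin.ext ?_
      -- The merged component keeps the label of the source, which lies below the deleted position.
      -- Hence `succAbove` does not shift it, and its slot is the one preceding the deleted factor.
      simp only [Fin.succAbove, Fin.lt_def, Fin.val_castSucc] at h2
      simp only [OrderIso.toEquiv_symm]
      split_ifs at h2 with h3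
      · rw [Fin.val_castSucc] at h2
        exact Nat.eq_sub_of_add_eq h2
      · rw [Fin.val_succ] at h2
        omega
  · exact idxIso_symm_insert he h h' (j := ⟨index H e.1, hle⟩) hj rfl

theorem coeffEquiv_edgeMap_left {H : Finset (V × V)} {e : V × V} {k : ℕ}
    (he : ¬ Conn H e.1 e.2) (h : Fintype.card (Idx H) = k + 1)
    (h' : Fintype.card (Idx (insert e H)) = k) (hi : index H e.1 = k + 1)
    (hi' : index H e.2 = 0) (x : Coeff R A M H) :
    coeffEquiv R A M (insert e H) h' (edgeMap R A M H e x) =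
      hd R A M k (k + 1) (coeffEquiv R A M H h x) := by
  have hlt : rep H e.2 < rep H e.1 := rep_lt_of_index_lt (by omega)
  have hmax : max (rep H e.1) (rep H e.2) = rep H e.1 := max_eq_left hlt.le
  have hmin : min (rep H e.1) (rep H e.2) = ⊥ := by
    rw [min_eq_right hlt.le, rep_eq_bot_of_index hi']
  have hj : index H (max (rep H e.1) (rep H e.2)) = (Fin.last k).1 + 1 := by
    rw [hmax, index_rep, hi, Fin.val_last]
  have hpos : ∀ v : Idx H, v.1 = max (rep H e.1) (rep H e.2) →
      (idxIso H h).symm v = Fin.last k := fun v hv => Fin.ext (by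
    have := idxIso_symm_val H h v
    rw [hv, hj] at this
    omega)
  unfold hd
  rw [dif_neg (lt_irrefl _)]
  unfold edgeMap
  rw [dif_neg he]
  simp only [LinearMap.comp_apply, LinearEquiv.coe_coe, coeffEquiv, LinearEquiv.trans_apply,
    LinearEquiv.apply_symm_apply, if_neg (not_lt.2 hlt.le), dif_pos hmin]
  exact relabel_absorb _ _ _ _ _ _ (fun a y => relabel_slotMulLeft _ _ _ _) (hpos _ rfl)
    (fun r => idxIso_symm_insert he h h' hj rfl) _

end Compare

/-! ## Spanning sub-graphs of the polygon -/

section Polygon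

variable {n : ℕ}

/-- The vertices whose outgoing edge in the polygon does not belong to `H`. -/
def cuts (H : Finset (Fin (n + 1) × Fin (n + 1))) : Finset (Fin (n + 1)) :=
  Finset.univ.filter fun v => (v, v + 1) ∉ H

/-- The spanning sub-graph of the polygon which consists of the edges with source outside `S`. -/
def uncut (S : Finset (Fin (n + 1))) : Finset (Fin (n + 1) × Fin (n + 1)) :=
  Sᶜ.image fun v => (v, v + 1)

theorem mem_cuts {H : Finset (Fin (n + 1) × Fin (n + 1))} {v : Fin (n + 1)} :
    v ∈ cuts H ↔ (v, v + 1) ∉ H := by simp [cuts]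

theorem mem_uncut {S : Finset (Fin (n + 1))} {e : Fin (n + 1) × Fin (n + 1)} :
    e ∈ uncut S ↔ e.1 ∉ S ∧ e.2 = e.1 + 1 := by
  unfold uncut
  rw [Finset.mem_image]
  constructor
  · rintro ⟨v, hv, rfl⟩
    exact ⟨Finset.mem_compl.1 hv, rfl⟩
  · rintro ⟨h, h'⟩
    exact ⟨e.1, Finset.mem_compl.2 h, Prod.ext rfl h'.symm⟩

theorem mem_polygon {hn : 1 ≤ n} {e : Fin (n + 1) × Fin (n + 1)} :
    e ∈ (polygon n hn).edges ↔ e.2 = e.1 + 1 := by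
  change e ∈ Finset.univ.image _ ↔ _
  rw [Finset.mem_image]
  constructor
  · rintro ⟨v, -, rfl⟩
    rfl
  · exact fun h => ⟨e.1, Finset.mem_univ _, Prod.ext rfl h.symm⟩

theorem cuts_uncut (S : Finset (Fin (n + 1))) : cuts (uncut S) = S := by
  ext v
  simp [mem_cuts, mem_uncut]

theorem uncut_cuts {hn : 1 ≤ n} {H : Finset (Fin (n + 1) × Fin (n + 1))}
    (h : H ⊆ (polygon n hn).edges) : uncut (cuts H) = H := by
  ext ⟨a, b⟩
  rw [mem_uncut, mem_cuts, not_not]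
  constructor
  · rintro ⟨h1, h2⟩
    simp only at h1 h2
    rwa [h2]
  · intro h1
    have h2 : b = a + 1 := mem_polygon.1 (h h1)
    subst h2
    exact ⟨h1, rfl⟩

theorem uncut_subset (hn : 1 ≤ n) (S : Finset (Fin (n + 1))) :
    uncut S ⊆ (polygon n hn).edges := fun _ he => mem_polygon.2 (mem_uncut.1 he).2

theorem card_uncut (S : Finset (Fin (n + 1))) : (uncut S).card + S.card = n + 1 := by
  unfold uncut
  rw [Finset.card_image_of_injective _ fun v w h => (Prod.ext_iff.1 h).1, Finset.card_compl,
    Fintype.card_fin]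
  have := Finset.card_le_univ S
  rw [Fintype.card_fin] at this
  omega

theorem insert_uncut {S : Finset (Fin (n + 1))} {v : Fin (n + 1)} :
    insert (v, v + 1) (uncut S) = uncut (S.erase v) := by
  ext ⟨a, b⟩
  simp only [Finset.mem_insert, mem_uncut, Finset.mem_erase, Prod.mk.injEq]
  constructor
  · rintro (⟨rfl, rfl⟩ | ⟨h, h'⟩)
    · simp
    · exact ⟨fun h1 => h h1.2, h'⟩
  · rintro ⟨h, rfl⟩
    by_cases h1 : a = v
    · exact Or.inl ⟨h1, by rw [h1]⟩
    · exact Or.inr ⟨fun h2 => h ⟨h1, h2⟩, rfl⟩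

/-! ### Components -/

theorem pos_zero (S : Finset (Fin (n + 1))) : pos S 0 = 0 := by
  simp [pos]

theorem pos_last {S : Finset (Fin (n + 1))} : pos S (Fin.last n) = (S.erase (Fin.last n)).card := by
  unfold pos
  congr 1
  ext v
  simp only [Finset.mem_filter, Finset.mem_erase, Fin.lt_last_iff_ne_last]
  tauto

theorem lt_add_one_iff {u v : Fin (n + 1)} (hv : v ≠ Fin.last n) : u < v + 1 ↔ u ≤ v := by
  rw [Fin.lt_def, Fin.le_def, Fin.val_add_one_of_lt (Fin.lt_last_iff_ne_last.2 hv)]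
  omega

theorem pos_add_one_of_notMem {S : Finset (Fin (n + 1))} {v : Fin (n + 1)}
    (hv : v ≠ Fin.last n) (h : v ∉ S) : pos S (v + 1) = pos S v := by
  unfold pos
  congr 1
  ext u
  simp only [Finset.mem_filter, lt_add_one_iff hv, le_iff_lt_or_eq]
  constructor
  · rintro ⟨h1, h2 | rfl⟩
    · exact ⟨h1, h2⟩
    · exact absurd h1 h
  · exact fun h1 => ⟨h1.1, Or.inl h1.2⟩

theorem pos_add_one_of_mem {S : Finset (Fin (n + 1))} {v : Fin (n + 1)}
    (hv : v ≠ Fin.last n) (h : v ∈ S) : pos S (v + 1) = pos S v + 1 := by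
  unfold pos
  rw [← Finset.card_insert_of_notMem (s := S.filter (· < v)) (a := v) (by simp)]
  congr 1
  ext u
  simp only [Finset.mem_filter, lt_add_one_iff hv, le_iff_lt_or_eq, Finset.mem_insert]
  constructor
  · rintro ⟨h1, h2 | rfl⟩
    · exact Or.inr ⟨h1, h2⟩
    · exact Or.inl rfl
  · rintro (rfl | h1)
    · exact ⟨h, Or.inr rfl⟩
    · exact ⟨h1.1, Or.inl h1.2⟩

theorem pos_add_one_mod {S : Finset (Fin (n + 1))} {v : Fin (n + 1)} (h : v ∈ S) :
    pos S (v + 1) % S.card = (pos S v + 1) % S.card := by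
  by_cases hv : v = Fin.last n
  · subst hv
    rw [Fin.last_add_one, pos_zero, pos_last, Finset.card_erase_add_one h, Nat.mod_self,
      Nat.zero_mod]
  · rw [pos_add_one_of_mem hv h]

theorem conn_uncut_edge {S : Finset (Fin (n + 1))} {v : Fin (n + 1)} (h : v ∉ S) :
    Conn (uncut S) v (v + 1) := Relation.EqvGen.rel _ _ (mem_uncut.2 ⟨h, rfl⟩)

theorem conn_uncut_of_le {S : Finset (Fin (n + 1))} {a b : Fin (n + 1)} (hab : a ≤ b)
    (h : pos S a = pos S b) : Conn (uncut S) a b := by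
  obtain ⟨d, hd⟩ : ∃ d, b.1 = a.1 + d := ⟨b.1 - a.1, by rw [Fin.le_def] at hab; omega⟩
  induction d generalizing a with
  | zero => rw [Fin.ext hd]; exact Conn.refl _ _
  | succ d ih =>
    have hlt : a < b := by rw [Fin.lt_def]; omega
    have hl : a ≠ Fin.last n := (hlt.trans_le (Fin.le_last b)).ne
    have ha : a ∉ S := fun ha => absurd h (pos_lt_pos ha le_rfl hlt).ne
    have hv : (a + 1).1 = a.1 + 1 := Fin.val_add_one_of_lt (Fin.lt_last_iff_ne_last.2 hl)
    exact (conn_uncut_edge ha).trans (ih (by rw [Fin.le_def]; omega)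
      ((pos_add_one_of_notMem hl ha).trans h) (by omega))

theorem conn_uncut_of_pos_eq {S : Finset (Fin (n + 1))} {a b : Fin (n + 1)}
    (h : pos S a = pos S b) : Conn (uncut S) a b := by
  rcases le_total a b with hab | hab
  · exact conn_uncut_of_le hab h
  · exact (conn_uncut_of_le hab h.symm).symm

/-- A vertex preceded by all cuts lies after the last of them, so its arc runs through the closing
edge `v_n → v_0`. -/
theorem conn_uncut_zero {S : Finset (Fin (n + 1))} {a : Fin (n + 1)}
    (h : pos S a = S.card) : Conn (uncut S) a 0 := by
  have h1 : pos S a ≤ pos S (Fin.last n) := pos_mono S (Fin.le_last a)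
  have hl : Fin.last n ∉ S := fun hl => by
    have := pos_lt_card hl
    omega
  have h2 : pos S (Fin.last n) = S.card := by rw [pos_last, Finset.erase_eq_of_notMem hl]
  have := (conn_uncut_of_pos_eq (h.trans h2.symm)).trans (conn_uncut_edge hl)
  rwa [Fin.last_add_one] at this

/-- Along an edge of the sub-graph no cut is passed, so the number of preceding cuts is constant,
except that the closing edge resets it from `S.card` to `0`. The remainder modulo `S.card` absorbs
this reset. -/
theorem conn_uncut_iff {S : Finset (Fin (n + 1))} {a b : Fin (n + 1)} :
    Conn (uncut S) a b ↔ pos S a % S.card = pos S b % S.card := by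
  constructor
  · intro h
    induction h with
    | rel x y hxy =>
      obtain ⟨h1, h2⟩ := mem_uncut.1 hxy
      simp only at h1 h2
      subst h2
      by_cases hx : x = Fin.last n
      · subst hx
        rw [Fin.last_add_one, pos_zero, pos_last, Finset.erase_eq_of_notMem h1, Nat.mod_self,
          Nat.zero_mod]
      · rw [pos_add_one_of_notMem hx h1]
    | refl x => rfl
    | symm x y _ ih => exact ih.symm
    | trans x y z _ _ ih ih' => exact ih.trans ih'
  · intro h
    have key : ∀ x : Fin (n + 1), Conn (uncut S) x 0 ∧ pos S x % S.card = 0 ∨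
        pos S x % S.card = pos S x := fun x => by
      rcases (pos_le_card S x).lt_or_eq with hx | hx
      · exact Or.inr (Nat.mod_eq_of_lt hx)
      · exact Or.inl ⟨conn_uncut_zero hx, by rw [hx, Nat.mod_self]⟩
    rcases key a with ⟨ha, ha'⟩ | ha <;> rcases key b with ⟨hb, hb'⟩ | hb
    · exact ha.trans hb.symm
    · exact ha.trans (conn_uncut_of_pos_eq (by rw [pos_zero, ← hb, ← h, ha']))
    · exact (conn_uncut_of_pos_eq (by rw [pos_zero, ← ha, h, hb'])).trans hb.symm
    · exact conn_uncut_of_pos_eq (by rw [← ha, h, hb])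

section Index

variable {S : Finset (Fin (n + 1))} (hS : S.Nonempty)
include hS

theorem pos_isRep {r : Fin (n + 1)} (hr : rep (uncut S) r = r) : pos S r % S.card = pos S r := by
  refine Nat.mod_eq_of_lt ((pos_le_card S r).lt_of_ne fun h => ?_)
  have h0 : r = 0 := by
    rw [← hr, rep_eq_of_conn (conn_uncut_zero h)]
    exact rep_bot _
  rw [h0, pos_zero] at h
  exact absurd h.symm (Finset.card_pos.2 hS).ne'

theorem pos_lt_of_isRep {r r' : Fin (n + 1)} (hr : rep (uncut S) r = r)
    (hr' : rep (uncut S) r' = r') (h : r < r') : pos S r < pos S r' := by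
  refine (pos_mono S h.le).lt_of_ne fun h' => h.ne ?_
  rw [← hr, ← hr', rep_eq_of_conn (conn_uncut_of_pos_eq h')]

theorem pos_rep (v : Fin (n + 1)) : pos S (rep (uncut S) v) = pos S v % S.card := by
  rw [← pos_isRep hS (rep_rep _ v), conn_uncut_iff.1 (conn_rep (uncut S) v)]

theorem exists_isRep {j : ℕ} (hj : j < S.card) :
    ∃ r, rep (uncut S) r = r ∧ pos S r = j := by
  have : j ∈ S.image (pos S) := by rwa [image_pos, Finset.mem_range]
  obtain ⟨v, -, hv⟩ := Finset.mem_image.1 this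
  exact ⟨rep (uncut S) v, rep_rep _ _, by rw [pos_rep hS, hv, Nat.mod_eq_of_lt hj]⟩

theorem index_uncut (v : Fin (n + 1)) : index (uncut S) v = pos S v % S.card := by
  rw [← pos_rep hS, index, ← Finset.card_range (pos S (rep (uncut S) v)),
    ← Finset.card_image_of_injOn (f := pos S)]
  · congr 1
    ext j
    rw [Finset.mem_image, Finset.mem_range]
    constructor
    · rintro ⟨r, hr, rfl⟩
      rw [Finset.mem_filter] at hr
      exact pos_lt_of_isRep hS hr.2.1 (rep_rep _ _) hr.2.2
    · intro hj
      have hlt : pos S (rep (uncut S) v) < S.card := by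
        rw [pos_rep hS]
        exact Nat.mod_lt _ (Finset.card_pos.2 hS)
      obtain ⟨r, hr, rfl⟩ := exists_isRep hS (hj.trans hlt)
      refine ⟨r, Finset.mem_filter.2 ⟨Finset.mem_univ _, hr, ?_⟩, rfl⟩
      by_contra h
      exact absurd (pos_mono S (not_lt.1 h)) (not_le.2 hj)
  · intro r hr r' hr' h
    have hr := (Finset.mem_filter.1 hr).2.1
    have hr' := (Finset.mem_filter.1 hr').2.1
    rw [← hr, ← hr', rep_eq_of_conn (conn_uncut_of_pos_eq h)]

theorem card_idx_uncut : Fintype.card (Idx (uncut S)) + 1 = S.card := by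
  have hc : 0 < S.card := Finset.card_pos.2 hS
  rw [Fintype.card_subtype]
  have : (Finset.univ.filter fun r => rep (uncut S) r = r ∧ r ≠ ⊥).image (pos S) =
      (Finset.range S.card).erase 0 := by
    ext j
    rw [Finset.mem_image, Finset.mem_erase, Finset.mem_range]
    constructor
    · rintro ⟨r, hr, rfl⟩
      obtain ⟨h1, h2⟩ := (Finset.mem_filter.1 hr).2
      refine ⟨fun h => h2 ?_, ?_⟩
      · rw [← h1, rep_eq_of_conn (conn_uncut_of_pos_eq (h.trans (pos_zero S).symm))]
        exact rep_bot _
      · rw [← pos_isRep hS h1]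
        exact Nat.mod_lt _ hc
    · rintro ⟨h1, h2⟩
      obtain ⟨r, hr, rfl⟩ := exists_isRep hS h2
      refine ⟨r, Finset.mem_filter.2 ⟨Finset.mem_univ _, hr, ?_⟩, rfl⟩
      rintro rfl
      exact h1 (pos_zero S)
  have h := congrArg Finset.card this
  rw [Finset.card_image_of_injOn, Finset.card_erase_of_mem (Finset.mem_range.2 hc),
    Finset.card_range] at h
  · rw [h]
    omega
  · intro r hr r' hr' h
    have hr := (Finset.mem_filter.1 hr).2.1
    have hr' := (Finset.mem_filter.1 hr').2.1
    rw [← hr, ← hr', rep_eq_of_conn (conn_uncut_of_pos_eq h)]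

end Index

/-! ### Signs -/

/-- If the target is the next component, the exponent is the source index plus two; for the edge
back to the base component it is the source index itself. So `σ` already gives the alternating sign.
-/
theorem sigma_uncut {S : Finset (Fin (n + 1))} {v : Fin (n + 1)} (hv : v ∈ S) :
    (Even (sigma (uncut S) (v, v + 1)) ↔ Even (pos S v)) := by
  have hne : S.Nonempty := ⟨v, hv⟩
  have hlt := pos_lt_card hv
  unfold sigma
  simp only
  rw [index_uncut hne, index_uncut hne, pos_add_one_mod hv, Nat.mod_eq_of_lt hlt]
  rcases (show pos S v + 1 ≤ S.card from hlt).lt_or_eq with h | h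
  · rw [Nat.mod_eq_of_lt h, if_pos (Nat.lt_succ_self _)]
    simp [Nat.even_add_one]
  · rw [h, Nat.mod_self, if_neg (Nat.not_lt_zero _)]

/-- Each vertex before `v` either is a cut, counted by `pos`, or is the source of an edge of the
sub-graph, counted by `zeta`. -/
theorem zeta_uncut {S : Finset (Fin (n + 1))} {v : Fin (n + 1)} (hv : v ∈ S) :
    zeta (uncut S) (v, v + 1) + pos S v = v.1 := by
  have : (uncut S).filter (fun f => toLex f < toLex (v, v + 1)) =
      ((Finset.Iio v).filter (· ∉ S)).image fun w => (w, w + 1) := by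
    ext ⟨a, b⟩
    simp only [Finset.mem_filter, mem_uncut, Finset.mem_image, Finset.mem_Iio, Prod.Lex.toLex_lt_toLex,
      Prod.mk.injEq]
    constructor
    · rintro ⟨⟨h1, rfl⟩, h2 | ⟨rfl, -⟩⟩
      · exact ⟨a, ⟨h2, h1⟩, rfl, rfl⟩
      · exact absurd hv h1
    · rintro ⟨w, ⟨h1, h2⟩, rfl, rfl⟩
      exact ⟨⟨h2, rfl⟩, Or.inl h1⟩
  have e : zeta (uncut S) (v, v + 1) = ((Finset.Iio v).filter (· ∉ S)).card := by
    unfold zeta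
    rw [← Finset.card_image_of_injective ((Finset.Iio v).filter (· ∉ S))
      (f := fun w : Fin (n + 1) => (w, w + 1)) fun a b h => (Prod.ext_iff.1 h).1, ← this]
  have e' : pos S v = ((Finset.Iio v).filter (· ∈ S)).card := by
    unfold pos
    congr 1
    ext u
    simp [and_comm]
  rw [e, e', add_comm, Finset.card_filter_add_card_filter_not, Fin.card_Iio]

/-! ### Multipaths of the polygon -/

/-- The vertex reached from `a` after `t` edges of the polygon. -/
def walk (a : Fin (n + 1)) (t : ℕ) : Fin (n + 1) := a + Fin.ofNat (n + 1) t

theorem walk_zero (a : Fin (n + 1)) : walk a 0 = a := by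
  unfold walk
  exact add_zero a

theorem val_walk (a : Fin (n + 1)) (t : ℕ) : (walk a t).1 = (a.1 + t) % (n + 1) := by
  simp [walk, Fin.val_add, Fin.ofNat]

theorem walk_walk (a : Fin (n + 1)) (s t : ℕ) : walk (walk a s) t = walk a (s + t) := by
  refine Fin.ext ?_
  rw [val_walk, val_walk, val_walk, Nat.mod_add_mod, add_assoc]

theorem walk_one (a : Fin (n + 1)) : walk a 1 = a + 1 := rfl

theorem walk_succ (a : Fin (n + 1)) (t : ℕ) : walk a (t + 1) = walk a t + 1 := by
  rw [← walk_walk, walk_one]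

theorem walk_add_one (a : Fin (n + 1)) (t : ℕ) : walk (a + 1) t = walk a (t + 1) := by
  rw [← walk_one, walk_walk, Nat.add_comm 1 t]

theorem walk_self (a : Fin (n + 1)) : walk a (n + 1) = a := by
  refine Fin.ext ?_
  rw [val_walk, Nat.add_mod_right, Nat.mod_eq_of_lt a.2]

theorem walk_injective (a : Fin (n + 1)) {s t : ℕ} (hs : s ≤ n) (ht : t ≤ n)
    (h : walk a s = walk a t) : s = t := by
  have := congrArg Fin.val (add_left_cancel h)
  simp only [Fin.ofNat] at this
  rwa [Nat.mod_eq_of_lt (by omega), Nat.mod_eq_of_lt (by omega)] at this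

theorem exists_walk (a b : Fin (n + 1)) : ∃ t ≤ n, walk a t = b := by
  refine ⟨(b - a).1, Nat.lt_succ_iff.1 (b - a).2, ?_⟩
  unfold walk
  rw [show Fin.ofNat (n + 1) (b - a).1 = b - a from Fin.ext (Nat.mod_eq_of_lt (b - a).2),
    add_sub_cancel]

/-- The component is the arc from just after the nearest cut behind `v` up to the first cut ahead.
One cut is enough to bound its length by `n`, which keeps it from closing up. -/
theorem exists_component {S : Finset (Fin (n + 1))} (hS : S.Nonempty) (v : Fin (n + 1)) :
    ∃ (a : Fin (n + 1)) (L : ℕ), L ≤ n ∧ (∀ t < L, walk a t ∉ S) ∧ walk a L ∈ S ∧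
      ∀ w, Conn (uncut S) v w ↔ ∃ t ≤ L, w = walk a t := by
  classical
  have hex : ∃ t, ∃ c ∈ S, walk (c + 1) t = v := by
    obtain ⟨c, hc⟩ := hS
    obtain ⟨t, -, ht⟩ := exists_walk (c + 1) v
    exact ⟨t, c, hc, ht⟩
  obtain ⟨c, hc, ht⟩ := Nat.find_spec hex
  -- A cut strictly between `c` and `v` would give a shorter walk to `v`.
  have hmin : ∀ t' < Nat.find hex, walk (c + 1) t' ∉ S := fun t' ht' hmem => by
    refine Nat.find_min hex (m := Nat.find hex - (t' + 1)) (by omega) ⟨_, hmem, ?_⟩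
    rw [walk_add_one, walk_walk]
    refine Eq.trans ?_ ht
    congr 1
    omega
  have hex' : ∃ L, walk (c + 1) L ∈ S := ⟨n, by rwa [walk_add_one, walk_self]⟩
  have hL : walk (c + 1) (Nat.find hex') ∈ S := Nat.find_spec hex'
  have hlt : ∀ t < Nat.find hex', walk (c + 1) t ∉ S := fun t => Nat.find_min hex'
  have hle : Nat.find hex ≤ Nat.find hex' := by
    by_contra h
    exact hmin _ (not_le.1 h) hL
  refine ⟨c + 1, Nat.find hex', Nat.find_min' hex' (by rwa [walk_add_one, walk_self]), hlt, hL,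
    fun w => ⟨fun h => ?_, ?_⟩⟩
  · have key : ∀ {x y}, Conn (uncut S) x y → ((∃ t ≤ Nat.find hex', x = walk (c + 1) t) ↔
        ∃ t ≤ Nat.find hex', y = walk (c + 1) t) := by
      intro x y hxy
      induction hxy with
      | rel x y hxy =>
        obtain ⟨h1, h2⟩ := mem_uncut.1 hxy
        simp only at h1 h2
        subst h2
        constructor
        · rintro ⟨t, ht, rfl⟩
          refine ⟨t + 1, Nat.succ_le_of_lt (ht.lt_of_ne ?_), (walk_succ _ _).symm⟩
          rintro rfl
          exact h1 hL
        -- The vertex before the start of the arc is the cut `c`, whose outgoing edge is absent.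
        · rintro ⟨_ | t, ht, h3⟩
          · rw [walk_zero] at h3
            exact absurd (add_right_cancel h3 ▸ hc) h1
          · rw [walk_succ] at h3
            exact ⟨t, by omega, add_right_cancel h3⟩
      | refl x => rfl
      | symm x y _ ih => exact ih.symm
      | trans x y z _ _ ih ih' => exact ih.trans ih'
    exact (key h).1 ⟨_, hle, ht.symm⟩
  · have key : ∀ t ≤ Nat.find hex', Conn (uncut S) (c + 1) (walk (c + 1) t) := by
      intro t
      induction t with
      | zero => exact fun _ => by rw [walk_zero]; exact Conn.refl _ _
      | succ t ih =>
        intro h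
        rw [walk_succ]
        exact (ih (by omega)).trans (conn_uncut_edge (hlt t (by omega)))
    rintro ⟨t, h, rfl⟩
    have := key _ hle
    rw [ht] at this
    exact this.symm.trans (key t h)

theorem isMultipath_uncut (hn : 1 ≤ n) {S : Finset (Fin (n + 1))} (hS : S.Nonempty) :
    IsMultipath (polygon n hn) (uncut S) := by
  refine ⟨uncut_subset hn S, fun v => ?_⟩
  obtain ⟨a, L, hL, ha, hmem, hc⟩ := exists_component hS v
  obtain _ | k := L
  · left
    intro w hw
    obtain ⟨t, ht, h⟩ := (hc w).1 hw
    obtain ⟨s, hs, h'⟩ := (hc v).1 (Conn.refl _ _)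
    rw [h, h', Nat.le_zero.1 ht, Nat.le_zero.1 hs]
  · right
    refine ⟨k, fun i => (walk a i.1, walk a (i.1 + 1)),
      ⟨fun i => rfl, fun i j h => ?_, fun h => ?_⟩, fun f => ?_⟩
    · rcases h with h | h
      · exact Fin.ext (walk_injective a (by omega) (by omega) h)
      · exact Fin.ext (Nat.succ_injective (walk_injective a (by omega) (by omega) h))
    · have := walk_injective a (by simp) (by rw [Fin.val_last]; exact hL) h
      simp at this
    · rw [mem_uncut, hc]
      constructor
      · rintro ⟨i, rfl⟩
        exact ⟨⟨ha _ i.2, walk_succ _ _⟩, i.1, by omega, rfl⟩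
      · rintro ⟨⟨h1, h2⟩, t, ht, h3⟩
        have hlt : t < k + 1 := ht.lt_of_ne (by
          rintro rfl
          exact h1 (h3 ▸ hmem))
        exact ⟨⟨t, hlt⟩, Prod.ext h3.symm (by rw [h2, h3]; exact walk_succ a t)⟩

end Polygon

/-! ## Comparison of the cochain complexes with chains on a simplex -/

section Transport

variable {R A M : Type*} [CommRing R] [Ring A] [Algebra R A] [AddCommGroup M] [Module R M]
  [Module A M] [Module Aᵐᵒᵖ M] [SMulCommClass A Aᵐᵒᵖ M] [IsScalarTower R A M]
  [IsScalarTower R Aᵐᵒᵖ M] {n : ℕ}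

/-- With at least two cuts the edge at `v` joins distinct components, of index `pos S v` and its
cyclic successor. Without wrap-around this is an inner or initial face, with wrap-around the last
face. -/
theorem coeffEquiv_edgeMap_uncut {S : Finset (Fin (n + 1))} {k : ℕ} (hS : S.card = k + 2)
    {v : Fin (n + 1)} (hv : v ∈ S) (h : Fintype.card (Idx (uncut S)) = k + 1)
    (h' : Fintype.card (Idx (insert (v, v + 1) (uncut S))) = k) (x : Coeff R A M (uncut S)) :
    coeffEquiv R A M (insert (v, v + 1) (uncut S)) h' (edgeMap R A M (uncut S) (v, v + 1) x) =
      hd R A M k (pos S v) (coeffEquiv R A M (uncut S) h x) := by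
  have hne : S.Nonempty := ⟨v, hv⟩
  have hlt := pos_lt_card hv
  have h1 : index (uncut S) v = pos S v := by rw [index_uncut hne, Nat.mod_eq_of_lt hlt]
  have h2 : index (uncut S) (v + 1) = (pos S v + 1) % S.card := by
    rw [index_uncut hne, pos_add_one_mod hv]
  have hc : ¬ Conn (uncut S) v (v + 1) := fun hc => by
    have h3 : index (uncut S) v = index (uncut S) (v + 1) := by
      rw [← index_rep, rep_eq_of_conn hc, index_rep]
    rw [h1, h2] at h3
    rcases (show pos S v + 1 ≤ S.card from hlt).lt_or_eq with h4 | h4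
    · rw [Nat.mod_eq_of_lt h4] at h3
      omega
    · rw [h4, Nat.mod_self] at h3
      omega
  rcases (show pos S v + 1 ≤ S.card from hlt).lt_or_eq with h4 | h4
  · rw [Nat.mod_eq_of_lt h4] at h2
    rw [coeffEquiv_edgeMap_right hc h h' (by rw [h2, h1]), h1]
  · rw [h4, Nat.mod_self] at h2
    have h5 : pos S v = k + 1 := by omega
    rw [coeffEquiv_edgeMap_left hc h h' (by rw [h1, h5]) h2, h5]

theorem edgeMap_eq_zero {S : Finset (Fin (n + 1))} (hS : S.card = 1) (e : Fin (n + 1) × Fin (n + 1)) :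
    edgeMap R A M (uncut S) e = 0 := by
  unfold edgeMap
  rw [dif_pos (conn_uncut_iff.2 (by rw [hS, Nat.mod_one, Nat.mod_one]))]

theorem mem_hcycles {k : ℕ} {x : HChain R A M k} :
    x ∈ hcycles R A M k ↔ (hochschild R A M).IsBCycle k x := by
  obtain _ | k := k
  · exact ⟨fun _ => trivial, fun _ => Submodule.mem_top⟩
  · change hboundary R A M k x = 0 ↔ _
    rw [hboundary_eq]
    rfl

/-- A family of spanning sub-graphs of the polygon which contains all proper ones, with a choice
of signs which is equivalent to the alternating one. -/
structure SignedFamily (R : Type*) [CommRing R] (n : ℕ)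
    (P : Set (Finset (Fin (n + 1) × Fin (n + 1))))
    (ε : Finset (Fin (n + 1) × Fin (n + 1)) → Fin (n + 1) × Fin (n + 1) → ℕ) where
  eq_uncut : ∀ H ∈ P, uncut (cuts H) = H
  uncut_mem : ∀ S : Finset (Fin (n + 1)), S.Nonempty → uncut S ∈ P
  sign : Finset (Fin (n + 1)) → R
  sign_mul_self : ∀ S, sign S * sign S = 1
  sign_erase : ∀ S, 2 ≤ S.card → ∀ v ∈ S,
    (-1 : R) ^ ε (uncut S) (v, v + 1) * sign (S.erase v) = sign S * (-1) ^ pos S v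

namespace SignedFamily

variable {P : Set (Finset (Fin (n + 1) × Fin (n + 1)))}
  {ε : Finset (Fin (n + 1) × Fin (n + 1)) → Fin (n + 1) × Fin (n + 1) → ℕ}
  (F : SignedFamily R n P ε) {i k : ℕ} (hik : i + k = n)
include F

theorem card_cuts {H : Finset (Fin (n + 1) × Fin (n + 1))} (hH : H ∈ P) :
    H.card + (cuts H).card = n + 1 := by
  have := card_uncut (cuts H)
  rwa [F.eq_uncut H hH] at this

include hik

theorem card_cuts_eq {H : Finset (Fin (n + 1) × Fin (n + 1))} (hH : H ∈ P) (h : H.card = i) :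
    (cuts H).card = k + 1 := by
  have := F.card_cuts hH
  omega

theorem card_idx {H : Finset (Fin (n + 1) × Fin (n + 1))} (hH : H ∈ P) (h : H.card = i) :
    Fintype.card (Idx H) = k := by
  have h1 := F.card_cuts_eq hik hH h
  have h2 := card_idx_uncut (S := cuts H) (Finset.card_pos.1 (by omega))
  rw [F.eq_uncut H hH] at h2
  omega

variable (A M)

/-- Cochains as chains on the simplex with vertices `Fin (n + 1)`, with coefficients in the
simplicial module of Hochschild chains. -/
def toChains : Cochain R A M P i →ₗ[R] (Finset (Fin (n + 1)) → HChain R A M k) :=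
  DirectSum.toModule R _ _ fun H =>
    LinearMap.single R (fun _ : Finset (Fin (n + 1)) => HChain R A M k) (cuts H.1) ∘ₗ
      (F.sign (cuts H.1) • (coeffEquiv R A M H.1 (F.card_idx hik H.2.1 H.2.2)).toLinearMap)

open Classical in
/-- The inverse of `toChains`. -/
def ofChains (y : Finset (Fin (n + 1)) → HChain R A M k) : Cochain R A M P i :=
  ∑ H : {H : Finset (Fin (n + 1) × Fin (n + 1)) // H ∈ P ∧ H.card = i},
    DirectSum.lof R {H : Finset (Fin (n + 1) × Fin (n + 1)) // H ∈ P ∧ H.card = i}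
      (fun H => Coeff R A M H.1) H
      ((coeffEquiv R A M H.1 (F.card_idx hik H.2.1 H.2.2)).symm
        (F.sign (cuts H.1) • y (cuts H.1)))

variable {A M}

theorem toChains_lof (H : {H : Finset (Fin (n + 1) × Fin (n + 1)) // H ∈ P ∧ H.card = i})
    (x : Coeff R A M H.1) :
    F.toChains A M hik (DirectSum.lof R _ (fun H : {H : Finset (Fin (n + 1) × Fin (n + 1)) //
      H ∈ P ∧ H.card = i} => Coeff R A M H.1) H x) =
      Pi.single (cuts H.1)
        (F.sign (cuts H.1) • coeffEquiv R A M H.1 (F.card_idx hik H.2.1 H.2.2) x) := by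
  unfold toChains
  rw [DirectSum.toModule_lof]
  rfl

theorem toChains_ofChains (y : Finset (Fin (n + 1)) → HChain R A M k)
    {S : Finset (Fin (n + 1))} (hS : S.card = k + 1) :
    F.toChains A M hik (F.ofChains A M hik y) S = y S := by
  classical
  have hmem : uncut S ∈ P ∧ (uncut S).card = i :=
    ⟨F.uncut_mem S (Finset.card_pos.1 (by omega)), by have := card_uncut S; omega⟩
  unfold ofChains
  rw [map_sum, Finset.sum_apply, Finset.sum_eq_single ⟨uncut S, hmem⟩]
  · rw [toChains_lof, LinearEquiv.apply_symm_apply, smul_smul, F.sign_mul_self, one_smul,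
      cuts_uncut, Pi.single_eq_same]
  · intro H _ hH
    rw [toChains_lof, Pi.single_eq_of_ne]
    rintro rfl
    exact hH (Subtype.ext (F.eq_uncut _ H.2.1).symm)
  · exact fun h => absurd (Finset.mem_univ _) h

theorem ofChains_toChains (c : Cochain R A M P i) :
    F.ofChains A M hik (F.toChains A M hik c) = c := by
  classical
  induction c using DirectSum.induction_on with
  | zero => simp [ofChains]
  | add x y hx hy =>
    rw [map_add]
    conv_rhs => rw [← hx, ← hy]
    unfold ofChains
    rw [← Finset.sum_add_distrib]
    refine Finset.sum_congr rfl fun H _ => ?_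
    rw [Pi.add_apply, smul_add, map_add, map_add]
  | of H x =>
    rw [← DirectSum.lof_eq_of R, toChains_lof, ofChains, Finset.sum_eq_single H]
    · rw [Pi.single_eq_same, smul_smul, F.sign_mul_self, one_smul, LinearEquiv.symm_apply_apply]
    · intro H' _ hH
      rw [Pi.single_eq_of_ne, smul_zero, map_zero, map_zero]
      intro h
      refine hH (Subtype.ext ?_)
      rw [← F.eq_uncut _ H'.2.1, h, F.eq_uncut _ H.2.1]
    · exact fun h => absurd (Finset.mem_univ _) h

theorem toChains_injective : Function.Injective (F.toChains A M hik) :=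
  Function.LeftInverse.injective (F.ofChains_toChains hik)

theorem toChains_apply_eq_zero (c : Cochain R A M P i) {S : Finset (Fin (n + 1))}
    (hS : S.card ≠ k + 1) : F.toChains A M hik c S = 0 := by
  induction c using DirectSum.induction_on with
  | zero => simp
  | add x y hx hy => rw [map_add, Pi.add_apply, hx, hy, add_zero]
  | of H x =>
    rw [← DirectSum.lof_eq_of R, toChains_lof, Pi.single_eq_of_ne]
    rintro rfl
    exact hS (F.card_cuts_eq hik H.2.1 H.2.2)

omit hik in
theorem toChains_diff_lof (hik : i + (k + 1) = n) (hik' : i + 1 + k = n)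
    {S : Finset (Fin (n + 1))} (hS : uncut S ∈ P ∧ (uncut S).card = i)
    (x : Coeff R A M (uncut S)) :
    F.toChains A M hik' (diff R A M P ε i (DirectSum.lof R _
      (fun H : {H : Finset (Fin (n + 1) × Fin (n + 1)) // H ∈ P ∧ H.card = i} =>
        Coeff R A M H.1) ⟨uncut S, hS⟩ x)) =
      (hochschild R A M).bdry k (Pi.single S
        (F.sign S • coeffEquiv R A M (uncut S) (F.card_idx hik hS.1 hS.2) x)) := by
  have hcard : S.card = k + 2 := by
    have := F.card_cuts_eq hik hS.1 hS.2
    rwa [cuts_uncut] at this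
  rw [FaceDegeneracy.bdry_pi_single, diff, DirectSum.toModule_lof, LinearMap.sum_apply, map_sum]
  have hinj : Function.Injective fun v : Fin (n + 1) => (v, v + 1) :=
    fun v w h => (Prod.ext_iff.1 h).1
  -- The differential runs over all pairs of vertices, but a pair contributes only if it is a
  -- polygon edge starting at a cut.
  rw [← Finset.sum_subset (Finset.subset_univ (S.image fun v => (v, v + 1))),
    Finset.sum_image hinj.injOn]
  · refine Finset.sum_congr rfl fun v hv => ?_
    have hc : cuts (insert (v, v + 1) (uncut S)) = S.erase v := by
      rw [insert_uncut, cuts_uncut]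
    have hmem : (v, v + 1) ∉ uncut S ∧ insert (v, v + 1) (uncut S) ∈ P := by
      refine ⟨fun h => (mem_uncut.1 h).1 hv, ?_⟩
      rw [insert_uncut]
      refine F.uncut_mem _ (Finset.card_pos.1 ?_)
      rw [Finset.card_erase_of_mem hv]
      omega
    rw [dif_pos hmem, LinearMap.smul_apply, map_smul, LinearMap.comp_apply, toChains_lof]
    simp only [hc]
    rw [coeffEquiv_edgeMap_uncut hcard hv (F.card_idx hik hS.1 hS.2), ← Pi.single_smul, smul_smul,
      F.sign_erase S (by omega) v hv, map_smul, smul_smul, mul_comm (F.sign S)]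
    rfl
  · intro e _ he
    split_ifs with h
    · exfalso
      have h1 := F.eq_uncut _ h.2
      have h2 : e ∈ uncut (cuts (insert e (uncut S))) := h1.symm ▸ Finset.mem_insert_self _ _
      have h3 := (mem_uncut.1 h2).2
      refine he (Finset.mem_image.2 ⟨e.1, ?_, Prod.ext rfl h3.symm⟩)
      by_contra h4
      exact h.1 (mem_uncut.2 ⟨h4, h3⟩)
    · simp

omit hik in
theorem toChains_diff (hik : i + (k + 1) = n) (hik' : i + 1 + k = n) (c : Cochain R A M P i) :
    F.toChains A M hik' (diff R A M P ε i c) =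
      (hochschild R A M).bdry k (F.toChains A M hik c) := by
  induction c using DirectSum.induction_on with
  | zero =>
    funext U
    simp [FaceDegeneracy.bdry]
  | add x y hx hy =>
    funext U
    rw [map_add, map_add, hx, hy, map_add]
    exact ((hochschild R A M).bdry_add k _ _ U).symm
  | of H x =>
    obtain ⟨H, hH⟩ := H
    obtain ⟨S, rfl⟩ : ∃ S, H = uncut S := ⟨cuts H, (F.eq_uncut H hH.1).symm⟩
    rw [← DirectSum.lof_eq_of R, F.toChains_diff_lof hik hik' hH, toChains_lof]
    simp only [cuts_uncut]

-- In degree `n` there is a single cut, hence a single component, and every edge map is zero. For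
-- the chromatic complex this disposes of the full polygon in degree `n + 1`.
omit hik in
theorem diff_eq_zero (c : Cochain R A M P n) : diff R A M P ε n c = 0 := by
  induction c using DirectSum.induction_on with
  | zero => simp
  | add x y hx hy => rw [map_add, hx, hy, add_zero]
  | of H x =>
    obtain ⟨H, hH⟩ := H
    obtain ⟨S, rfl⟩ : ∃ S, H = uncut S := ⟨cuts H, (F.eq_uncut H hH.1).symm⟩
    have hS : S.card = 1 := by
      have := F.card_cuts_eq (i := n) (k := 0) rfl hH.1 hH.2
      rwa [cuts_uncut] at this
    rw [← DirectSum.lof_eq_of R, diff, DirectSum.toModule_lof, LinearMap.sum_apply]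
    refine Finset.sum_eq_zero fun e _ => ?_
    split_ifs with h
    · rw [edgeMap_eq_zero hS]
      simp
    · simp

theorem isCycle_toChains (c : Cochain R A M P i) (hc : diff R A M P ε i c = 0) :
    (hochschild R A M).IsCycle k (F.toChains A M hik c) := by
  obtain _ | k := k
  · trivial
  intro U _
  rw [← F.toChains_diff hik (by omega), hc, map_zero]
  rfl

theorem diff_ofChains {y : Finset (Fin (n + 1)) → HChain R A M k}
    (hy : (hochschild R A M).IsCycle k y) : diff R A M P ε i (F.ofChains A M hik y) = 0 := by
  obtain _ | k := k
  · obtain rfl : i = n := hik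
    exact F.diff_eq_zero _
  refine F.toChains_injective (k := k) (by omega) ?_
  funext S
  rw [map_zero]
  by_cases hS : S.card = k + 1
  · rw [F.toChains_diff hik, (hochschild R A M).bdry_congr
      (fun S hS => F.toChains_ofChains hik y hS) hS, hy S hS]
    rfl
  · exact F.toChains_apply_eq_zero _ _ hS

/-- The cohomology in degree `i ≥ 1` is the Hochschild homology in degree `n - i`. -/
theorem nonempty_equiv (hi : 1 ≤ i) :
    Nonempty (Cohomology R A M P ε i ≃ₗ[R] HochschildHomology R A M k) := by
  obtain ⟨i, rfl⟩ : ∃ j, i = j + 1 := ⟨i - 1, by omega⟩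
  -- The isomorphism is induced by the sum of the values over all faces of the simplex.
  let tot : Cochain R A M P (i + 1) →ₗ[R] HChain R A M k :=
    { toFun := fun c => FaceDegeneracy.total k (F.toChains A M hik c)
      map_add' := fun c c' => by
        rw [map_add]
        exact Finset.sum_add_distrib
      map_smul' := fun r c => by
        rw [map_smul]
        unfold FaceDegeneracy.total
        rw [RingHom.id_apply, Finset.smul_sum]
        rfl }
  have htot : ∀ c ∈ LinearMap.ker (diff R A M P ε (i + 1)), tot c ∈ hcycles R A M k :=
    fun c hc => mem_hcycles.2 ((hochschild R A M).isBCycle_total (F.isCycle_toChains hik c hc))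
  let f : LinearMap.ker (diff R A M P ε (i + 1)) →ₗ[R] HochschildHomology R A M k :=
    Submodule.mkQ _ ∘ₗ tot.restrict htot
  have hf : Function.Surjective f := by
    intro q
    obtain ⟨⟨x, hx⟩, rfl⟩ := Submodule.mkQ_surjective _ q
    obtain ⟨y, hy, hxy⟩ := (hochschild R A M).exists_total_eq (n := n) (by omega) x
      (mem_hcycles.1 hx)
    refine ⟨⟨F.ofChains A M hik y, LinearMap.mem_ker.2 (F.diff_ofChains hik hy)⟩, ?_⟩
    have e : tot (F.ofChains A M hik y) = FaceDegeneracy.total k y :=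
      FaceDegeneracy.total_congr fun S hS => F.toChains_ofChains hik y hS
    rw [eq_comm]
    refine (Submodule.Quotient.eq _).2 ?_
    change x - tot (F.ofChains A M hik y) ∈ LinearMap.range (hboundary R A M k)
    rw [e, hboundary_eq]
    exact hxy
  have hker : LinearMap.ker f =
      (coboundaries R A M P ε (i + 1)).submoduleOf (LinearMap.ker (diff R A M P ε (i + 1))) := by
    ext ⟨c, hc⟩
    rw [LinearMap.mem_ker]
    have h1 : f ⟨c, hc⟩ = 0 ↔ tot c ∈ LinearMap.range ((hochschild R A M).b k) := by
      rw [← hboundary_eq]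
      exact Submodule.Quotient.mk_eq_zero _
    rw [h1]
    change _ ↔ c ∈ LinearMap.range (diff R A M P ε i)
    constructor
    · intro h
      -- The bound `k < n` required here is the condition that the cohomological degree is at least
      -- one.
      obtain ⟨u, hu⟩ := (hochschild R A M).exists_eq_bdry (by omega) _
        (F.isCycle_toChains hik c hc) h
      refine ⟨F.ofChains A M (k := k + 1) (by omega) u, F.toChains_injective hik ?_⟩
      funext S
      by_cases hS : S.card = k + 1
      · rw [F.toChains_diff (by omega), hu S hS]
        exact (hochschild R A M).bdry_congr (fun S hS => F.toChains_ofChains _ u hS) hS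
      · rw [F.toChains_apply_eq_zero _ _ hS, F.toChains_apply_eq_zero _ _ hS]
    · rintro ⟨c', rfl⟩
      refine ⟨FaceDegeneracy.total (k + 1) (F.toChains A M (k := k + 1) (by omega) c'), ?_⟩
      rw [FaceDegeneracy.b_total, ← F.toChains_diff _ hik]
      rfl
  exact ⟨(Submodule.quotEquivOfEq _ _ hker.symm).trans (f.quotKerEquivOfSurjective hf)⟩

end SignedFamily

variable (R)

/-- The multipaths of the polygon, with the signs `σ`. -/
def multipathFamily (hn : 1 ≤ n) : SignedFamily R n (pathPoset (polygon n hn)) sigma where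
  eq_uncut H hH := uncut_cuts hH.1
  uncut_mem S hS := isMultipath_uncut hn hS
  sign _ := 1
  sign_mul_self _ := mul_one 1
  sign_erase S _ v hv := by
    rw [mul_one, one_mul, neg_one_pow_congr (sigma_uncut hv)]

/-- The spanning sub-graphs of the polygon, with the signs `ζ`. -/
def chromaticFamily (hn : 1 ≤ n) : SignedFamily R n (spanningSubgraphs (polygon n hn)) zeta where
  eq_uncut H hH := uncut_cuts hH
  uncut_mem S _ := uncut_subset hn S
  -- Since `ζ` and `pos S v` add up to `v`, the two signs differ by `(-1)^v`. This is the ratio of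
  -- the rescalings at `S` and `S.erase v`.
  sign S := (-1) ^ ∑ v ∈ S, v.1
  sign_mul_self S := by rw [← mul_pow]; simp
  sign_erase S _ v hv := by
    rw [← pow_add, ← pow_add, ← Finset.add_sum_erase S _ hv, ← zeta_uncut hv]
    refine neg_one_pow_congr ?_
    simp only [Nat.even_add]
    tauto

end Transport

end MultipathHH

end

theorem mainTheorem3 {R A M : Type*} [CommRing R] [Ring A] [Algebra R A] [Module.Flat R A]
    [AddCommGroup M] [Module R M] [Module A M] [Module Aᵐᵒᵖ M] [SMulCommClass A Aᵐᵒᵖ M]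
    [IsScalarTower R A M] [IsScalarTower R Aᵐᵒᵖ M]
    (n : ℕ) (hn : 1 ≤ n) (i : ℕ) (hi : 1 ≤ i) (hin : i ≤ n) :
    Nonempty (MultipathHH.MultipathCohomology R A M (MultipathHH.polygon n hn) i ≃ₗ[R]
        MultipathHH.ChromaticCohomology R A M (MultipathHH.polygon n hn) i) ∧
      Nonempty (MultipathHH.ChromaticCohomology R A M (MultipathHH.polygon n hn) i ≃ₗ[R]
        MultipathHH.HochschildHomology R A M (n - i)) := by
  obtain ⟨e⟩ := (MultipathHH.multipathFamily R hn).nonempty_equiv (A := A) (M := M)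
    (Nat.add_sub_of_le hin) hi
  obtain ⟨e'⟩ := (MultipathHH.chromaticFamily R hn).nonempty_equiv (A := A) (M := M)
    (Nat.add_sub_of_le hin) hi
  exact ⟨⟨e.trans e'.symm⟩, ⟨e'⟩⟩
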